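/- Let $q,\Delta:[0,\frac{\pi}{2})\cup(\frac{\pi}{2},\pi]\to\mathbb{R}$ be continuous with finite one-sided limits at $\frac{\pi}{2}$, with $\Delta\ge 0$, $x-\Delta(x)\ge 0$ for $x\in[0,\frac{\pi}{2})$ and $x-\Delta(x)\ge\frac{\pi}{2}$ for $x\in(\frac{\pi}{2},\pi]$. Let $\alpha,\beta,\delta\in\mathbb{R}$ with $\sin\alpha\ne 0$, $\sin\beta\neq 0$, $\delta\ne 0$. Consider the boundary value problem with real spectral parameter $\lambda$ $$y''(x)+q(x)\,y(x-\Delta(x))+\lambda y(x)=0,\qquad x\in[0,\tfrac{\pi}{2})\cup(\tfrac{\pi}{2},\pi],$$ $$y(0)\cos\alpha+y'(0)\sin\alpha=0,\qquad y(\pi)\cos\beta+y'(\pi)\sin\beta=0,$$ $$y(\tfrac{\pi}{2}-0)=\sqrt[3]{\lambda}\,\delta\,y(\tfrac{\pi}{2}+0),\qquad y'(\tfrac{\pi}{2}-0)=\sqrt[3]{\lambda}\,\delta\,y'(\tfrac{\pi}{2}+0),$$ where for $x>\frac{\pi}{2}$ with $x-\Delta(x)=\frac{\pi}{2}$ the value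 $y(\frac{\pi}{2})$ means $y(\frac{\pi}{2}+0)$. Assume: (a) $q'$ and $\Delta''$ exist and are bounded on $[0,\frac{\pi}{2})\cup(\frac{\pi}{2},\pi]$ and have finite one-sided limits at $\frac{\pi}{2}$; (b) $\Delta'(x)\le 1$ on $[0,\frac{\pi}{2})\cup(\frac{\pi}{2},\pi]$, $\Delta(0)=0$ and $\lim_{x\to\frac{\pi}{2}+0}\Delta(x)=0$. For $0\le x\le\pi$ put $K(x,n,\Delta)=\frac12\int_0^x q(\tau)\sin(n\Delta(\tau))\,d\tau$ and $L(x,n,\Delta)=\frac12\int_0^x q(\tau)\cos(n\Delta(\tau))\,d\tau$. Then for every sufficiently large natural number $n$ the problem has exactly one eigenvalue $\lambda_n=s_n^2$, $s_n>0$, near $n^2$ (that is, with $|s_n-n|\le\frac12$), it satisfies $s_n=n+O(n^{-1/3})$, and it has an eigenfunction $u_n$ normalized by $u_n(0)=\sin\alpha$, $u_n'(0)=-\cos\alpha$. As $n\to\infty$, uniformly in $x$, every such eigenfunction satisfies $$u_n(x)=\sin\alpha\left\{\cos nx\left[1+\frac{K(x,n,\Delta)}{n}\right]-\frac{\sin nx}{n\pi}\Big[\big(\cot\beta-\cot\alpha-L(\pi,n,\Delta)\big)x+\big(\cot\alpha+L(x,n,\Delta)\big)\pi\Big]\right\}+O\!\left(\frac1{n^2}\right)$$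 for $x\in[0,\frac{\pi}{2})$, and $$u_n(x)=\frac{\sin\alpha}{n^{2/3}\delta}\left\{\cos nx\left[1+\frac{K(x,n,\Delta)}{n}\right]-\frac{\sin nx}{n\pi}\Big[\big(\cot\beta-\cot\alpha-L(\pi,n,\Delta)\big)x+\big(\cot\alpha+L(x,n,\Delta)\big)\pi\Big]\right\}+O\!\left(\frac1{n^2}\right)$$ for $x\in(\frac{\pi}{2},\pi]$. -/

import Mathlib

open Set Filter Topology

noncomputable section

namespace RetardedBVP

/-- The domain `[0, π/2) ∪ (π/2, π]`. -/
def dom : Set ℝ := Ico 0 (Real.pi / 2) ∪ Ioc (Real.pi / 2) Real.pi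

/-- The closed left half `[0, π/2]`. -/
def left : Set ℝ := Icc 0 (Real.pi / 2)

/-- The closed right half `[π/2, π]`. -/
def right : Set ℝ := Icc (Real.pi / 2) Real.pi

/-- The real cube root, on all of `ℝ`. -/
def cbrt (t : ℝ) : ℝ := if 0 ≤ t then t ^ (1 / 3 : ℝ) else -((-t) ^ (1 / 3 : ℝ))

/-- `f` has finite one-sided limits at `π/2`. -/
def HasSideLimits (f : ℝ → ℝ) : Prop :=
  (∃ l, Tendsto f (𝓝[<] (Real.pi / 2)) (𝓝 l)) ∧ (∃ l, Tendsto f (𝓝[>] (Real.pi / 2)) (𝓝 l))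

/-- Standing assumptions on the potential `q` and the retardation `Δ`. -/
structure Admissible (q Δ : ℝ → ℝ) : Prop where
  q_cont : ContinuousOn q dom
  q_lim : HasSideLimits q
  delay_cont : ContinuousOn Δ dom
  delay_lim : HasSideLimits Δ
  delay_nonneg : ∀ x ∈ dom, 0 ≤ Δ x
  delay_left : ∀ x ∈ Ico 0 (Real.pi / 2), 0 ≤ x - Δ x
  delay_right : ∀ x ∈ Ioc (Real.pi / 2) Real.pi, Real.pi / 2 ≤ x - Δ x

/-- Condition a): `q'` and `Δ''` exist, are bounded on `[0, π/2) ∪ (π/2, π]` (one-sided derivatives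
at `0` and at `π`) and have finite one-sided limits at `π/2`. -/
structure CondA (q Δ : ℝ → ℝ) : Prop where
  q_diff : DifferentiableOn ℝ q dom
  q_bdd : ∃ M, ∀ x ∈ dom, |derivWithin q dom x| ≤ M
  q_lim : HasSideLimits (derivWithin q dom)
  delay_diff : DifferentiableOn ℝ Δ dom
  delay_diff2 : DifferentiableOn ℝ (derivWithin Δ dom) dom
  delay_bdd : ∃ M, ∀ x ∈ dom, |derivWithin (derivWithin Δ dom) dom x| ≤ M
  delay_lim : HasSideLimits (derivWithin (derivWithin Δ dom) dom)

/-- Condition b): `Δ' ≤ 1`, `Δ(0) = 0`, `Δ(π/2 + 0) = 0`. -/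
structure CondB (Δ : ℝ → ℝ) : Prop where
  deriv_le : ∀ x ∈ dom, derivWithin Δ dom x ≤ 1
  zero : Δ 0 = 0
  lim_right : Tendsto Δ (𝓝[>] (Real.pi / 2)) (𝓝 0)

/-- `(y₁, y₂)` solves `y''(x) + q(x) y(x - Δ(x)) + lam y(x) = 0` on `[0, π/2) ∪ (π/2, π]`.
The function `y` is `y₁` on `[0, π/2)` and `y₂` on `(π/2, π]`; `y₁(π/2)`, `y₂(π/2)` and the
one-sided derivatives there are the limits `y(π/2 ∓ 0)`, `y'(π/2 ∓ 0)`. -/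
structure IsSolution (q Δ : ℝ → ℝ) (lam : ℝ) (y₁ y₂ : ℝ → ℝ) : Prop where
  diff₁ : DifferentiableOn ℝ y₁ left
  cont₁ : ContinuousOn (derivWithin y₁ left) left
  eqn₁ : ∀ x ∈ Ico 0 (Real.pi / 2),
    HasDerivWithinAt (derivWithin y₁ left) (-(q x * y₁ (x - Δ x) + lam * y₁ x)) left x
  diff₂ : DifferentiableOn ℝ y₂ right
  cont₂ : ContinuousOn (derivWithin y₂ right) right
  eqn₂ : ∀ x ∈ Ioc (Real.pi / 2) Real.pi,
    HasDerivWithinAt (derivWithin y₂ right) (-(q x * y₂ (x - Δ x) + lam * y₂ x)) right x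

/-- `(y₁, y₂)` is an eigenfunction of the boundary value transmission problem, with eigenvalue
`lam`: a solution that satisfies the boundary and transmission conditions and does not vanish
identically. -/
structure IsEigenfunction (q Δ : ℝ → ℝ) (α β δ lam : ℝ) (y₁ y₂ : ℝ → ℝ) : Prop where
  sol : IsSolution q Δ lam y₁ y₂
  bc_zero : y₁ 0 * Real.cos α + derivWithin y₁ left 0 * Real.sin α = 0
  bc_pi : y₂ Real.pi * Real.cos β + derivWithin y₂ right Real.pi * Real.sin β = 0
  trans : y₁ (Real.pi / 2) - cbrt lam * δ * y₂ (Real.pi / 2) = 0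
  trans_deriv : derivWithin y₁ left (Real.pi / 2)
    - cbrt lam * δ * derivWithin y₂ right (Real.pi / 2) = 0
  nontrivial : (∃ x ∈ Ico 0 (Real.pi / 2), y₁ x ≠ 0) ∨
    (∃ x ∈ Ioc (Real.pi / 2) Real.pi, y₂ x ≠ 0)

/-- `lam` is an eigenvalue of the problem. -/
def IsEigenvalue (q Δ : ℝ → ℝ) (α β δ lam : ℝ) : Prop :=
  ∃ y₁ y₂ : ℝ → ℝ, IsEigenfunction q Δ α β δ lam y₁ y₂

/-- The eigenfunction normalized by `y(0) = sin α`, `y'(0) = -cos α`. -/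
structure IsNormalizedEigenfunction (q Δ : ℝ → ℝ) (α β δ lam : ℝ) (y₁ y₂ : ℝ → ℝ) : Prop where
  eigen : IsEigenfunction q Δ α β δ lam y₁ y₂
  init : y₁ 0 = Real.sin α
  init_deriv : derivWithin y₁ left 0 = -Real.cos α

/-- `K(x, s, Δ) = ½ ∫₀ˣ q(τ) sin (s Δ(τ)) dτ`. -/
def K (q Δ : ℝ → ℝ) (x s : ℝ) : ℝ := 1 / 2 * ∫ τ in (0 : ℝ)..x, q τ * Real.sin (s * Δ τ)

/-- `L(x, s, Δ) = ½ ∫₀ˣ q(τ) cos (s Δ(τ)) dτ`. -/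
def L (q Δ : ℝ → ℝ) (x s : ℝ) : ℝ := 1 / 2 * ∫ τ in (0 : ℝ)..x, q τ * Real.cos (s * Δ τ)

end RetardedBVP

end

/-!
Scale the right half of a solution by the transmission factor `κ = λ^(1/3) δ`. The delayed argument
of a point right of `π/2` stays right of `π/2`, so the scaled function solves the same linear
equation there, and the two transmission conditions say that it continues the left half with a
continuous derivative. With `λ = s²`, variation of constants turns the problem into one integral
equation on `[0, π]`,
`Y x = a cos sx + b sin sx / s - (1/s) ∫₀ˣ q(τ) sin s(x - τ) Y(τ - Δ τ) dτ`, with `a = sin α` and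
`b = -cos α` (`Admissible.exists_isVolterra_of_isSolution`,
`Admissible.exists_isSolution_of_isVolterra`).

For large `s` the integral operator halves the supremum norm. This single fact gives existence,
uniqueness up to scaling, a bound for `Y` independent of `s`, the leading term
`Y = a cos sx + O(1/s)`, and Lipschitz dependence of `Y` on `s`. Inserting the leading term into the
integral and using product-to-sum formulas leaves `K` and `L`, plus an integral with the phase
`2τ - Δ τ`; its derivative is at least `1`, so one integration by parts makes that integral `O(1/s)`
(`abs_sub_le_of_nonstationary`). Hence `Y` and `Y'(π)` are known up to `O(1/s²)` and `O(1/s)`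
(`DelayData.abs_integral_sub_le`).

The boundary condition at `π` becomes `s a sin β sin πs = R(s)` with `R` bounded and Lipschitz. As
`s sin πs` has slope of order `n` near `n`, there is exactly one root `s` within `1/2` of `n`, and
`s - n = O(1/n)` (`exists_unique_zero_near`). The second-order form of the same equation gives
`s = n + (cot β - cot α - L(π, n)) / (n π) + O(1/n²)` (`abs_shift_sub_le`), and substituting this
into the expansion of `Y` yields the representation on all of `[0, π]`
(`DelayData.exists_asymptotics`). On the right half it is divided by `s^(2/3) δ`, which may be
replaced by `n^(2/3) δ` at the cost of `O(1/n²)`.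
-/

namespace RetardedBVP

open Real MeasureTheory intervalIntegral

/-! ### Convolutions of a bounded function with the sine and the cosine -/

/-- A bounded function that is continuous off one point is integrable on bounded intervals. -/
lemma intervalIntegrable_of_continuousOn_compl {P : ℝ → ℝ} {c B : ℝ}
    (hP : ContinuousOn P {c}ᶜ) (hB : ∀ x, |P x| ≤ B) (a b : ℝ) :
    IntervalIntegrable P volume a b := by
  have hm : Measurable P := measurable_of_continuousOn_compl_singleton c hP
  rw [intervalIntegrable_iff]
  exact Measure.integrableOn_of_bounded (by simp) hm.aestronglyMeasurable
    (Eventually.of_forall hB)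

lemma intervalIntegrable_mul_of_continuousOn_compl {P w : ℝ → ℝ} {c B : ℝ}
    (hP : ContinuousOn P {c}ᶜ) (hB : ∀ x, |P x| ≤ B) (hw : Continuous w) (a b : ℝ) :
    IntervalIntegrable (fun τ => P τ * w τ) volume a b :=
  (intervalIntegrable_of_continuousOn_compl hP hB a b).mul_continuousOn hw.continuousOn

/-- The convolution `∫₀ˣ P(τ) sin s(x - τ) dτ`. -/
noncomputable def sinConv (P : ℝ → ℝ) (s x : ℝ) : ℝ := ∫ τ in (0 : ℝ)..x, P τ * sin (s * x - s * τ)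

/-- The convolution `∫₀ˣ P(τ) cos s(x - τ) dτ`. -/
noncomputable def cosConv (P : ℝ → ℝ) (s x : ℝ) : ℝ := ∫ τ in (0 : ℝ)..x, P τ * cos (s * x - s * τ)

section

variable {P : ℝ → ℝ} {c B : ℝ}

lemma sinConv_eq (hP : ContinuousOn P {c}ᶜ) (hB : ∀ x, |P x| ≤ B) (s x : ℝ) :
    sinConv P s x = sin (s * x) * (∫ τ in (0 : ℝ)..x, P τ * cos (s * τ))
      - cos (s * x) * ∫ τ in (0 : ℝ)..x, P τ * sin (s * τ) := by
  have h1 := intervalIntegrable_mul_of_continuousOn_compl hP hB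
    (w := fun τ => cos (s * τ)) (by fun_prop) 0 x
  have h2 := intervalIntegrable_mul_of_continuousOn_compl hP hB
    (w := fun τ => sin (s * τ)) (by fun_prop) 0 x
  rw [sinConv, ← intervalIntegral.integral_const_mul, ← intervalIntegral.integral_const_mul,
    ← intervalIntegral.integral_sub (h1.const_mul _) (h2.const_mul _)]
  refine intervalIntegral.integral_congr fun τ _ => ?_
  simp only [sin_sub]
  ring

lemma cosConv_eq (hP : ContinuousOn P {c}ᶜ) (hB : ∀ x, |P x| ≤ B) (s x : ℝ) :
    cosConv P s x = cos (s * x) * (∫ τ in (0 : ℝ)..x, P τ * cos (s * τ))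
      + sin (s * x) * ∫ τ in (0 : ℝ)..x, P τ * sin (s * τ) := by
  have h1 := intervalIntegrable_mul_of_continuousOn_compl hP hB
    (w := fun τ => cos (s * τ)) (by fun_prop) 0 x
  have h2 := intervalIntegrable_mul_of_continuousOn_compl hP hB
    (w := fun τ => sin (s * τ)) (by fun_prop) 0 x
  rw [cosConv, ← intervalIntegral.integral_const_mul, ← intervalIntegral.integral_const_mul,
    ← intervalIntegral.integral_add (h1.const_mul _) (h2.const_mul _)]
  refine intervalIntegral.integral_congr fun τ _ => ?_
  simp only [cos_sub]
  ring

lemma cosConv_eq_integral_sin (P : ℝ → ℝ) (s x : ℝ) :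
    cosConv P s x = ∫ τ in (0 : ℝ)..x, P τ * sin (s * x + π / 2 - s * τ) := by
  refine intervalIntegral.integral_congr fun τ _ => ?_
  rw [show s * x + π / 2 - s * τ = s * x - s * τ + π / 2 by ring, sin_add_pi_div_two]

lemma continuous_primitive_mul (hP : ContinuousOn P {c}ᶜ) (hB : ∀ x, |P x| ≤ B) {w : ℝ → ℝ}
    (hw : Continuous w) : Continuous fun x => ∫ τ in (0 : ℝ)..x, P τ * w τ :=
  intervalIntegral.continuous_primitive
    (intervalIntegrable_mul_of_continuousOn_compl hP hB hw) 0

lemma hasDerivAt_primitive_mul (hP : ContinuousOn P {c}ᶜ) (hB : ∀ x, |P x| ≤ B) {w : ℝ → ℝ}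
    (hw : Continuous w) {x : ℝ} (hx : x ≠ c) :
    HasDerivAt (fun x => ∫ τ in (0 : ℝ)..x, P τ * w τ) (P x * w x) x := by
  have hm : Measurable fun τ => P τ * w τ :=
    (measurable_of_continuousOn_compl_singleton c hP).mul hw.measurable
  exact intervalIntegral.integral_hasDerivAt_right
    (intervalIntegrable_mul_of_continuousOn_compl hP hB hw 0 x)
    hm.stronglyMeasurable.stronglyMeasurableAtFilter
    ((hP.continuousAt (isOpen_compl_singleton.mem_nhds hx)).mul hw.continuousAt)

lemma continuous_sinConv (hP : ContinuousOn P {c}ᶜ) (hB : ∀ x, |P x| ≤ B) (s : ℝ) :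
    Continuous (sinConv P s) := by
  rw [funext (sinConv_eq hP hB s)]
  have h1 := continuous_primitive_mul hP hB (w := fun τ => cos (s * τ)) (by fun_prop)
  have h2 := continuous_primitive_mul hP hB (w := fun τ => sin (s * τ)) (by fun_prop)
  fun_prop

lemma continuous_cosConv (hP : ContinuousOn P {c}ᶜ) (hB : ∀ x, |P x| ≤ B) (s : ℝ) :
    Continuous (cosConv P s) := by
  rw [funext (cosConv_eq hP hB s)]
  have h1 := continuous_primitive_mul hP hB (w := fun τ => cos (s * τ)) (by fun_prop)
  have h2 := continuous_primitive_mul hP hB (w := fun τ => sin (s * τ)) (by fun_prop)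
  fun_prop

/-- The kernel `sin s(x - τ)` vanishes at `τ = x`, so the sine convolution is differentiable even
at the point where `P` jumps. -/
lemma hasDerivAt_sinConv (hP : ContinuousOn P {c}ᶜ) (hB : ∀ x, |P x| ≤ B) (s x : ℝ) :
    HasDerivAt (sinConv P s) (s * cosConv P s x) x := by
  refine hasDerivAt_of_hasDerivAt_of_ne' (x := c) (g := fun x => s * cosConv P s x)
    (fun y hy => ?_) (continuous_sinConv hP hB s).continuousAt
    ((continuous_cosConv hP hB s).const_mul s).continuousAt x
  have h1 := hasDerivAt_primitive_mul hP hB (w := fun τ => cos (s * τ)) (by fun_prop) hy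
  have h2 := hasDerivAt_primitive_mul hP hB (w := fun τ => sin (s * τ)) (by fun_prop) hy
  have h3 : HasDerivAt (fun y => s * y) s y := by simpa using (hasDerivAt_id y).const_mul s
  rw [funext (sinConv_eq hP hB s)]
  refine ((h3.sin.mul h1).sub (h3.cos.mul h2)).congr_deriv ?_
  rw [cosConv_eq hP hB]
  ring

lemma hasDerivAt_cosConv (hP : ContinuousOn P {c}ᶜ) (hB : ∀ x, |P x| ≤ B) (s : ℝ) {x : ℝ}
    (hx : x ≠ c) : HasDerivAt (cosConv P s) (P x - s * sinConv P s x) x := by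
  have h1 := hasDerivAt_primitive_mul hP hB (w := fun τ => cos (s * τ)) (by fun_prop) hx
  have h2 := hasDerivAt_primitive_mul hP hB (w := fun τ => sin (s * τ)) (by fun_prop) hx
  have h3 : HasDerivAt (fun y => s * y) s x := by simpa using (hasDerivAt_id x).const_mul s
  rw [funext (cosConv_eq hP hB s)]
  refine ((h3.cos.mul h1).add (h3.sin.mul h2)).congr_deriv ?_
  rw [sinConv_eq hP hB]
  linear_combination P x * sin_sq_add_cos_sq (s * x)

end

/-! ### The integral equation -/

/-- Data of a retarded equation `y''(x) + Q(x) y(D x) + s² y(x) = 0` on `[0, π]`, extended to the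
whole line: `Q` is bounded by `M`, the argument `D` maps into `[0, π]`, and both are continuous off
the transmission point `π/2`. The field `osc` records that the phase `τ + D τ` is nonstationary;
it is the only place where smoothness of the coefficients matters. -/
structure DelayData (Q D : ℝ → ℝ) (M : ℝ) : Prop where
  contQ : ContinuousOn Q {π / 2}ᶜ
  contD : ContinuousOn D {π / 2}ᶜ
  bound : ∀ x, |Q x| ≤ M
  mem : ∀ x, D x ∈ Icc 0 π
  osc : ∀ s > 0, ∀ θ, ∀ x ∈ Icc 0 π, |∫ τ in (0 : ℝ)..x, Q τ * sin (θ - s * (τ + D τ))| ≤ M / s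

/-- `Y` solves the integral equation equivalent to the equation `y'' + Q (y ∘ D) + s² y = 0` with
initial values `y(0) = a`, `y'(0) = b`. -/
structure IsVolterra (Q D : ℝ → ℝ) (a b s : ℝ) (Y : ℝ → ℝ) : Prop where
  cont : Continuous Y
  eqn : ∀ x ∈ Icc 0 π,
    Y x = a * cos (s * x) + b * (sin (s * x) / s) - sinConv (fun τ => Q τ * Y (D τ)) s x / s

section

variable {Q D Y Z : ℝ → ℝ} {M B : ℝ}

lemma DelayData.nonneg (h : DelayData Q D M) : 0 ≤ M := (abs_nonneg _).trans (h.bound 0)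

lemma DelayData.continuousOn_mul (h : DelayData Q D M) (hY : Continuous Y) :
    ContinuousOn (fun τ => Q τ * Y (D τ)) {π / 2}ᶜ :=
  h.contQ.mul (hY.comp_continuousOn h.contD)

lemma exists_bound_Icc (hY : Continuous Y) : ∃ B, ∀ y ∈ Icc 0 π, |Y y| ≤ B := by
  obtain ⟨B, hB⟩ := (isCompact_Icc (a := (0 : ℝ)) (b := π)).exists_bound_of_continuousOn
    hY.continuousOn
  exact ⟨B, hB⟩

lemma DelayData.abs_mul_le (h : DelayData Q D M) (hB : ∀ y ∈ Icc 0 π, |Y y| ≤ B) (τ : ℝ) :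
    |Q τ * Y (D τ)| ≤ M * B := by
  rw [abs_mul]
  exact mul_le_mul (h.bound τ) (hB _ (h.mem τ)) (abs_nonneg _) h.nonneg

lemma DelayData.intervalIntegrable (h : DelayData Q D M) (hY : Continuous Y) {w : ℝ → ℝ}
    (hw : Continuous w) (a b : ℝ) :
    IntervalIntegrable (fun τ => Q τ * Y (D τ) * w τ) volume a b := by
  obtain ⟨B, hB⟩ := exists_bound_Icc hY
  exact intervalIntegrable_mul_of_continuousOn_compl (h.continuousOn_mul hY)
    (h.abs_mul_le hB) hw a b

/-- A bound of the integrals in the integral equation that needs no measurability. -/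
lemma abs_integral_le {f : ℝ → ℝ} {x : ℝ} (hx : x ∈ Icc 0 π) (h0 : 0 ≤ B)
    (hf : ∀ τ ∈ Icc 0 π, |f τ| ≤ B) : |∫ τ in (0 : ℝ)..x, f τ| ≤ B * π := by
  have h1 := intervalIntegral.norm_integral_le_of_norm_le_const (a := 0) (b := x) (C := B)
    (f := f) fun τ hτ => by
      rw [uIoc_of_le hx.1] at hτ
      exact hf τ ⟨hτ.1.le, hτ.2.trans hx.2⟩
  rw [sub_zero, abs_of_nonneg hx.1] at h1
  exact h1.trans (mul_le_mul_of_nonneg_left hx.2 h0)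

lemma DelayData.abs_integral_mul_le (h : DelayData Q D M) (hB : ∀ y ∈ Icc 0 π, |Y y| ≤ B)
    {w : ℝ → ℝ} {W x : ℝ} (hw : ∀ τ ∈ Icc 0 π, |w τ| ≤ W) (hx : x ∈ Icc 0 π) :
    |∫ τ in (0 : ℝ)..x, Q τ * Y (D τ) * w τ| ≤ M * B * W * π := by
  have hB0 : 0 ≤ B := (abs_nonneg _).trans (hB _ (h.mem 0))
  have hW0 : 0 ≤ W := (abs_nonneg _).trans (hw _ hx)
  refine abs_integral_le hx (mul_nonneg (mul_nonneg h.nonneg hB0) hW0) fun τ hτ => ?_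
  rw [abs_mul]
  exact mul_le_mul (h.abs_mul_le hB τ) (hw τ hτ) (abs_nonneg _)
    (mul_nonneg h.nonneg hB0)

/-- For `s ≥ 2πM` the integral operator halves the supremum norm. -/
lemma DelayData.abs_sinConv_div_le (h : DelayData Q D M) (hB : ∀ y ∈ Icc 0 π, |Y y| ≤ B)
    {s x : ℝ} (hs0 : 0 < s) (hs : 2 * π * M ≤ s) (hx : x ∈ Icc 0 π) :
    |sinConv (fun τ => Q τ * Y (D τ)) s x / s| ≤ B / 2 := by
  have hB0 : 0 ≤ B := (abs_nonneg _).trans (hB _ (h.mem 0))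
  have h1 := h.abs_integral_mul_le hB (w := fun τ => sin (s * x - s * τ)) (W := 1)
    (fun τ _ => abs_sin_le_one _) hx
  rw [abs_div, abs_of_pos hs0, div_le_iff₀ hs0]
  refine h1.trans ?_
  nlinarith

/-- A continuous function that is bounded by `c` plus half its own supremum is bounded by `2c`. -/
lemma abs_le_two_mul_of_bootstrap (hZ : Continuous Z) {c : ℝ}
    (h : ∀ B, (∀ y ∈ Icc 0 π, |Z y| ≤ B) → ∀ x ∈ Icc 0 π, |Z x| ≤ c + B / 2) :
    ∀ x ∈ Icc 0 π, |Z x| ≤ 2 * c := by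
  obtain ⟨x₀, hx₀, hmax⟩ := (isCompact_Icc (a := (0 : ℝ)) (b := π)).exists_isMaxOn
    (nonempty_Icc.2 pi_pos.le) hZ.abs.continuousOn
  intro x hx
  have h1 := h _ (fun y hy => hmax hy) x₀ hx₀
  have h2 : |Z x| ≤ |Z x₀| := hmax hx
  linarith

/-- Projection of the line onto `[0, π]`. -/
noncomputable def clamp (t : ℝ) : ℝ := max 0 (min t π)

lemma continuous_clamp : Continuous clamp := by unfold clamp; fun_prop

lemma clamp_mem (t : ℝ) : clamp t ∈ Icc 0 π :=
  ⟨le_max_left _ _, max_le pi_pos.le (min_le_right _ _)⟩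

lemma clamp_of_mem {t : ℝ} (ht : t ∈ Icc 0 π) : clamp t = t := by
  rw [clamp, min_eq_left ht.2, max_eq_right ht.1]

/-- Solvability of the integral equation for large `s`, by contraction. -/
lemma DelayData.exists_isVolterra (h : DelayData Q D M) (a b : ℝ) {s : ℝ} (hs0 : 0 < s)
    (hs : 2 * π * M ≤ s) : ∃ Y, IsVolterra Q D a b s Y := by
  let G : (ℝ → ℝ) → ℝ → ℝ := fun Y x =>
    a * cos (s * x) + b * (sin (s * x) / s) - sinConv (fun τ => Q τ * Y (D τ)) s x / s
  have hG : ∀ Y, Continuous Y → Continuous (G Y) := fun Y hY => by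
    obtain ⟨B, hB⟩ := exists_bound_Icc hY
    have := continuous_sinConv (h.continuousOn_mul hY) (h.abs_mul_le hB) s
    fun_prop
  have hbd : ∀ Y, Continuous Y → ∃ C, ∀ x, ‖G Y (clamp x)‖ ≤ C := fun Y hY => by
    obtain ⟨B, hB⟩ := exists_bound_Icc (hG Y hY)
    exact ⟨B, fun x => hB _ (clamp_mem x)⟩
  choose C hC using hbd
  let T : BoundedContinuousFunction ℝ ℝ → BoundedContinuousFunction ℝ ℝ := fun Y =>
    BoundedContinuousFunction.ofNormedAddCommGroup (fun x => G Y (clamp x))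
      ((hG Y Y.continuous).comp continuous_clamp) (C Y Y.continuous) (hC Y Y.continuous)
  have hT : ContractingWith (1 / 2) T := by
    refine ⟨by norm_num [← NNReal.coe_lt_coe], LipschitzWith.of_dist_le_mul fun Y Z => ?_⟩
    rw [BoundedContinuousFunction.dist_le (by positivity)]
    intro x
    have h1 : T Y x - T Z x
        = -(sinConv (fun τ => Q τ * (Y - Z) (D τ)) s (clamp x) / s) := by
      have e : sinConv (fun τ => Q τ * (Y - Z) (D τ)) s (clamp x)
          = sinConv (fun τ => Q τ * Y (D τ)) s (clamp x)
            - sinConv (fun τ => Q τ * Z (D τ)) s (clamp x) := by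
        unfold sinConv
        rw [← intervalIntegral.integral_sub
          (h.intervalIntegrable Y.continuous (by fun_prop) _ _)
          (h.intervalIntegrable Z.continuous (by fun_prop) _ _)]
        refine intervalIntegral.integral_congr fun τ _ => ?_
        simp only [BoundedContinuousFunction.coe_sub, Pi.sub_apply]
        ring
      simp only [T, G, BoundedContinuousFunction.coe_ofNormedAddCommGroup, e]
      ring
    rw [Real.dist_eq, h1, abs_neg]
    have h2 := h.abs_sinConv_div_le (Y := ⇑(Y - Z)) (B := dist Y Z)
      (fun y _ => by
        rw [dist_eq_norm]; exact (Y - Z).norm_coe_le_norm y) hs0 hs (clamp_mem x)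
    refine h2.trans (le_of_eq ?_)
    push_cast
    ring
  have hfix := hT.fixedPoint_isFixedPt
  refine ⟨hT.fixedPoint, (hT.fixedPoint).continuous, fun x hx => ?_⟩
  have h3 := congrArg (fun F : BoundedContinuousFunction ℝ ℝ => F x) hfix
  simp only [T, BoundedContinuousFunction.coe_ofNormedAddCommGroup, clamp_of_mem hx] at h3
  exact h3.symm

/-- Solutions of the integral equation for large `s` are unique up to the scaling of their initial
values. -/
lemma DelayData.eq_mul_of_isVolterra (h : DelayData Q D M) {a b s c : ℝ} (hs0 : 0 < s)
    (hs : 2 * π * M ≤ s) (hY : IsVolterra Q D a b s Y)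
    (hZ : IsVolterra Q D (c * a) (c * b) s Z) : ∀ x ∈ Icc 0 π, Z x = c * Y x := by
  have hd : Continuous fun x => Z x - c * Y x := by
    have := hY.cont; have := hZ.cont; fun_prop
  have key := abs_le_two_mul_of_bootstrap hd (c := 0) fun B hB x hx => by
    have e : Z x - c * Y x
        = -(sinConv (fun τ => Q τ * (fun x => Z x - c * Y x) (D τ)) s x / s) := by
      have e : sinConv (fun τ => Q τ * (fun x => Z x - c * Y x) (D τ)) s x
          = sinConv (fun τ => Q τ * Z (D τ)) s x - c * sinConv (fun τ => Q τ * Y (D τ)) s x := by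
        unfold sinConv
        rw [← intervalIntegral.integral_const_mul, ← intervalIntegral.integral_sub
          (h.intervalIntegrable hZ.cont (by fun_prop) _ _)
          ((h.intervalIntegrable hY.cont (by fun_prop) _ _).const_mul c)]
        refine intervalIntegral.integral_congr fun τ _ => ?_
        simp only
        ring
      rw [e, hZ.eqn x hx, hY.eqn x hx]
      ring
    have h2 := h.abs_sinConv_div_le hB hs0 hs hx
    rw [e, abs_neg]
    linarith
  intro x hx
  have := key x hx
  rw [mul_zero] at this
  exact sub_eq_zero.1 (abs_nonpos_iff.1 this)

end

/-! ### Bounds, Lipschitz dependence on the parameter, and expansions -/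

lemma abs_sin_mul_sub_le (s t : ℝ) {u : ℝ} (hu : |u| ≤ π) :
    |sin (s * u) - sin (t * u)| ≤ π * |s - t| := by
  refine (abs_sin_sub_sin_le _ _).trans ?_
  rw [← sub_mul, abs_mul, mul_comm]
  exact mul_le_mul_of_nonneg_right hu (abs_nonneg _)

lemma abs_cos_mul_sub_le (s t : ℝ) {u : ℝ} (hu : |u| ≤ π) :
    |cos (s * u) - cos (t * u)| ≤ π * |s - t| := by
  refine (abs_cos_sub_cos_le _ _).trans ?_
  rw [← sub_mul, abs_mul, mul_comm]
  exact mul_le_mul_of_nonneg_right hu (abs_nonneg _)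

lemma abs_sin_mul_div_sub_le {s t u : ℝ} (hs : 1 ≤ s) (ht : 1 ≤ t) (hu : |u| ≤ π) :
    |sin (s * u) / s - sin (t * u) / t| ≤ (π + 1) * |s - t| := by
  have hs0 : 0 < s := by linarith
  have ht0 : 0 < t := by linarith
  have e : sin (s * u) / s - sin (t * u) / t
      = (sin (s * u) - sin (t * u)) / s + sin (t * u) * ((t - s) / (s * t)) := by
    field_simp
    ring
  have h1 : |(sin (s * u) - sin (t * u)) / s| ≤ π * |s - t| := by
    rw [abs_div, abs_of_pos hs0]
    exact (div_le_self (abs_nonneg _) hs).trans (abs_sin_mul_sub_le s t hu)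
  have h2 : |sin (t * u) * ((t - s) / (s * t))| ≤ 1 * |s - t| := by
    rw [abs_mul, abs_div, abs_sub_comm t s, abs_of_pos (mul_pos hs0 ht0)]
    exact mul_le_mul (abs_sin_le_one _)
      (div_le_self (abs_nonneg _) (one_le_mul_of_one_le_of_one_le hs ht)) (by positivity)
      zero_le_one
  rw [e]
  refine (abs_add_le _ _).trans ?_
  linarith

lemma abs_sub_le_pi {x y : ℝ} (hx : x ∈ Icc 0 π) (hy : y ∈ Icc 0 π) : |x - y| ≤ π :=
  abs_le.2 ⟨by linarith [hx.1, hy.2], by linarith [hx.2, hy.1]⟩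

lemma abs_le_pi {x : ℝ} (hx : x ∈ Icc 0 π) : |x| ≤ π := by
  rw [abs_of_nonneg hx.1]; exact hx.2

section

variable {Q D Y Z : ℝ → ℝ} {M a b s t : ℝ}

lemma DelayData.abs_le_of_isVolterra (h : DelayData Q D M) (hs1 : 1 ≤ s) (hs : 2 * π * M ≤ s)
    (hY : IsVolterra Q D a b s Y) : ∀ x ∈ Icc 0 π, |Y x| ≤ 2 * (|a| + |b|) := by
  have hs0 : 0 < s := by linarith
  refine abs_le_two_mul_of_bootstrap hY.cont fun B hB x hx => ?_
  have h1 := h.abs_sinConv_div_le hB hs0 hs hx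
  have h2 : |a * cos (s * x)| ≤ |a| := by
    rw [abs_mul]; exact mul_le_of_le_one_right (abs_nonneg _) (abs_cos_le_one _)
  have h3 : |b * (sin (s * x) / s)| ≤ |b| := by
    rw [abs_mul, abs_div, abs_of_pos hs0]
    exact mul_le_of_le_one_right (abs_nonneg _)
      ((div_le_self (abs_nonneg _) hs1).trans (abs_sin_le_one _))
  rw [hY.eqn x hx]
  exact (abs_sub _ _).trans (add_le_add ((abs_add_le _ _).trans (add_le_add h2 h3)) h1)

/-- The leading term of the solutions for large `s`. -/
lemma DelayData.abs_sub_cos_le_of_isVolterra (h : DelayData Q D M) (hs1 : 1 ≤ s)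
    (hs : 2 * π * M ≤ s) (hY : IsVolterra Q D a b s Y) :
    ∀ x ∈ Icc 0 π, |Y x - a * cos (s * x)| ≤ (|b| + M * (2 * (|a| + |b|)) * π) / s := by
  intro x hx
  have hs0 : 0 < s := by linarith
  have hB := h.abs_le_of_isVolterra hs1 hs hY
  have h1 := h.abs_integral_mul_le hB (w := fun τ => sin (s * x - s * τ)) (W := 1)
    (fun τ _ => abs_sin_le_one _) hx
  have e : Y x - a * cos (s * x)
      = (b * sin (s * x) - sinConv (fun τ => Q τ * Y (D τ)) s x) / s := by
    rw [hY.eqn x hx]; ring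
  rw [e, abs_div, abs_of_pos hs0]
  refine div_le_div_of_nonneg_right ((abs_sub _ _).trans (add_le_add ?_ ?_)) hs0.le
  · rw [abs_mul]; exact mul_le_of_le_one_right (abs_nonneg _) (abs_sin_le_one _)
  · rw [mul_one] at h1; exact h1

/-- For large parameters the solutions are Lipschitz in the parameter. -/
lemma DelayData.abs_sub_le_of_isVolterra (h : DelayData Q D M) (hs1 : 1 ≤ s)
    (hs : 2 * π * M ≤ s) (ht1 : 1 ≤ t) (ht : 2 * π * M ≤ t)
    (hY : IsVolterra Q D a b s Y) (hZ : IsVolterra Q D a b t Z) :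
    ∀ x ∈ Icc 0 π, |Y x - Z x| ≤ 2 * ((|a| * π + |b| * (π + 1)
      + M * (2 * (|a| + |b|)) * (π + 1) * π) * |s - t|) := by
  have hs0 : 0 < s := by linarith
  have hYc := hY.cont
  have hZc := hZ.cont
  refine abs_le_two_mul_of_bootstrap (Z := fun x => Y x - Z x) (by fun_prop)
    fun B hB x hx => ?_
  have e : sinConv (fun τ => Q τ * Y (D τ)) s x / s - sinConv (fun τ => Q τ * Z (D τ)) t x / t
      = sinConv (fun τ => Q τ * (fun x => Y x - Z x) (D τ)) s x / s
        + ∫ τ in (0 : ℝ)..x, Q τ * Z (D τ)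
            * (sin (s * (x - τ)) / s - sin (t * (x - τ)) / t) := by
    unfold sinConv
    rw [← intervalIntegral.integral_div, ← intervalIntegral.integral_div,
      ← intervalIntegral.integral_div, ← intervalIntegral.integral_sub
        ((h.intervalIntegrable hYc (by fun_prop) _ _).div_const s)
        ((h.intervalIntegrable hZc (by fun_prop) _ _).div_const t),
      ← intervalIntegral.integral_add
        ((h.intervalIntegrable (Y := fun x => Y x - Z x) (by fun_prop)
          (by fun_prop) _ _).div_const s)
        (h.intervalIntegrable hZc (by fun_prop) _ _)]
    refine intervalIntegral.integral_congr fun τ _ => ?_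
    simp only [mul_sub]
    ring
  have h1 := h.abs_sinConv_div_le hB hs0 hs hx
  have h2 := h.abs_integral_mul_le (h.abs_le_of_isVolterra ht1 ht hZ)
    (w := fun τ => sin (s * (x - τ)) / s - sin (t * (x - τ)) / t) (W := (π + 1) * |s - t|)
    (fun τ hτ => abs_sin_mul_div_sub_le hs1 ht1 (abs_sub_le_pi hx hτ)) hx
  have h3 : |a * (cos (s * x) - cos (t * x))| ≤ |a| * (π * |s - t|) := by
    rw [abs_mul]
    exact mul_le_mul_of_nonneg_left (abs_cos_mul_sub_le s t (abs_le_pi hx)) (abs_nonneg _)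
  have h4 : |b * (sin (s * x) / s - sin (t * x) / t)| ≤ |b| * ((π + 1) * |s - t|) := by
    rw [abs_mul]
    exact mul_le_mul_of_nonneg_left (abs_sin_mul_div_sub_le hs1 ht1 (abs_le_pi hx))
      (abs_nonneg _)
  have e2 : Y x - Z x = a * (cos (s * x) - cos (t * x))
      + b * (sin (s * x) / s - sin (t * x) / t)
      - (sinConv (fun τ => Q τ * Y (D τ)) s x / s
        - sinConv (fun τ => Q τ * Z (D τ)) t x / t) := by
    rw [hY.eqn x hx, hZ.eqn x hx]; ring
  rw [e2, e]
  refine (abs_sub _ _).trans ?_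
  have h5 := abs_add_le (a * (cos (s * x) - cos (t * x)))
    (b * (sin (s * x) / s - sin (t * x) / t))
  have h6 := abs_add_le (sinConv (fun τ => Q τ * (fun x => Y x - Z x) (D τ)) s x / s)
    (∫ τ in (0 : ℝ)..x, Q τ * Z (D τ) * (sin (s * (x - τ)) / s - sin (t * (x - τ)) / t))
  linarith

lemma DelayData.intervalIntegrable_comp (h : DelayData Q D M) {g : ℝ × ℝ → ℝ}
    (hg : Continuous g) (hg1 : ∀ p, |g p| ≤ 1) (x y : ℝ) :
    IntervalIntegrable (fun τ => Q τ * g (τ, D τ)) volume x y := by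
  refine intervalIntegrable_of_continuousOn_compl (B := M)
    (h.contQ.mul (hg.comp_continuousOn (continuousOn_id.prodMk h.contD))) (fun τ => ?_) x y
  change |Q τ * g (τ, D τ)| ≤ M
  rw [abs_mul]
  exact (mul_le_of_le_one_right (abs_nonneg _) (hg1 _)).trans (h.bound τ)

lemma DelayData.abs_K_le (h : DelayData Q D M) (s : ℝ) {x : ℝ} (hx : x ∈ Icc 0 π) :
    |K Q (fun τ => τ - D τ) x s| ≤ M * π := by
  have h1 := abs_integral_le (f := fun τ => Q τ * sin (s * (τ - D τ))) hx h.nonneg fun τ _ => by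
    rw [abs_mul]
    exact (mul_le_of_le_one_right (abs_nonneg _) (abs_sin_le_one _)).trans (h.bound τ)
  rw [K, abs_mul, abs_of_pos (by norm_num : (0 : ℝ) < 1 / 2)]
  linarith [abs_nonneg (∫ τ in (0 : ℝ)..x, Q τ * sin (s * (τ - D τ)))]

lemma DelayData.abs_L_le (h : DelayData Q D M) (s : ℝ) {x : ℝ} (hx : x ∈ Icc 0 π) :
    |L Q (fun τ => τ - D τ) x s| ≤ M * π := by
  have h1 := abs_integral_le (f := fun τ => Q τ * cos (s * (τ - D τ))) hx h.nonneg fun τ _ => by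
    rw [abs_mul]
    exact (mul_le_of_le_one_right (abs_nonneg _) (abs_cos_le_one _)).trans (h.bound τ)
  rw [L, abs_mul, abs_of_pos (by norm_num : (0 : ℝ) < 1 / 2)]
  linarith [abs_nonneg (∫ τ in (0 : ℝ)..x, Q τ * cos (s * (τ - D τ)))]

lemma DelayData.abs_K_sub_le (h : DelayData Q D M) (s t : ℝ) {x : ℝ} (hx : x ∈ Icc 0 π) :
    |K Q (fun τ => τ - D τ) x s - K Q (fun τ => τ - D τ) x t| ≤ M * π * π * |s - t| := by
  have h1 := abs_integral_le
    (f := fun τ => Q τ * sin (s * (τ - D τ)) - Q τ * sin (t * (τ - D τ)))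
    (B := M * (π * |s - t|)) hx (by have := h.nonneg; positivity) fun τ hτ => by
      rw [← mul_sub, abs_mul]
      exact mul_le_mul (h.bound τ) (abs_sin_mul_sub_le s t (abs_sub_le_pi hτ (h.mem τ)))
        (abs_nonneg _) h.nonneg
  rw [intervalIntegral.integral_sub
    (h.intervalIntegrable_comp (g := fun p => sin (s * (p.1 - p.2))) (by fun_prop)
      (fun _ => abs_sin_le_one _) _ _)
    (h.intervalIntegrable_comp (g := fun p => sin (t * (p.1 - p.2))) (by fun_prop)
      (fun _ => abs_sin_le_one _) _ _)] at h1
  rw [K, K, ← mul_sub, abs_mul, abs_of_pos (by norm_num : (0 : ℝ) < 1 / 2)]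
  have := (abs_nonneg _).trans h1
  linarith

lemma DelayData.abs_L_sub_le (h : DelayData Q D M) (s t : ℝ) {x : ℝ} (hx : x ∈ Icc 0 π) :
    |L Q (fun τ => τ - D τ) x s - L Q (fun τ => τ - D τ) x t| ≤ M * π * π * |s - t| := by
  have h1 := abs_integral_le
    (f := fun τ => Q τ * cos (s * (τ - D τ)) - Q τ * cos (t * (τ - D τ)))
    (B := M * (π * |s - t|)) hx (by have := h.nonneg; positivity) fun τ hτ => by
      rw [← mul_sub, abs_mul]
      exact mul_le_mul (h.bound τ) (abs_cos_mul_sub_le s t (abs_sub_le_pi hτ (h.mem τ)))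
        (abs_nonneg _) h.nonneg
  rw [intervalIntegral.integral_sub
    (h.intervalIntegrable_comp (g := fun p => cos (s * (p.1 - p.2))) (by fun_prop)
      (fun _ => abs_cos_le_one _) _ _)
    (h.intervalIntegrable_comp (g := fun p => cos (t * (p.1 - p.2))) (by fun_prop)
      (fun _ => abs_cos_le_one _) _ _)] at h1
  rw [L, L, ← mul_sub, abs_mul, abs_of_pos (by norm_num : (0 : ℝ) < 1 / 2)]
  have := (abs_nonneg _).trans h1
  linarith

/-- Product-to-sum: against the leading term `cos (s D τ)` the kernel splits into a nonoscillating
part, which produces `K` and `L`, and a part with the nonstationary phase `τ + D τ`. -/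
lemma DelayData.integral_mul_cos_eq (h : DelayData Q D M) (s θ x : ℝ) :
    ∫ τ in (0 : ℝ)..x, Q τ * cos (s * D τ) * sin (θ - s * τ)
      = sin θ * L Q (fun τ => τ - D τ) x s - cos θ * K Q (fun τ => τ - D τ) x s
        + 1 / 2 * ∫ τ in (0 : ℝ)..x, Q τ * sin (θ - s * (τ + D τ)) := by
  have i1 := h.intervalIntegrable_comp (g := fun p => cos (s * (p.1 - p.2))) (by fun_prop)
    (fun _ => abs_cos_le_one _) 0 x
  have i2 := h.intervalIntegrable_comp (g := fun p => sin (s * (p.1 - p.2))) (by fun_prop)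
    (fun _ => abs_sin_le_one _) 0 x
  have i3 := h.intervalIntegrable_comp (g := fun p => sin (θ - s * (p.1 + p.2))) (by fun_prop)
    (fun _ => abs_sin_le_one _) 0 x
  rw [K, L]
  simp only [← mul_assoc]
  rw [← intervalIntegral.integral_const_mul, ← intervalIntegral.integral_const_mul,
    ← intervalIntegral.integral_const_mul,
    ← intervalIntegral.integral_sub (i1.const_mul _) (i2.const_mul _),
    ← intervalIntegral.integral_add ((i1.const_mul _).sub (i2.const_mul _)) (i3.const_mul _)]
  refine intervalIntegral.integral_congr fun τ _ => ?_
  simp only [mul_add, mul_sub, cos_sub, sin_sub, sin_add, cos_add]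
  ring

/-- The integral term of the integral equation and of its derivative (`θ = s x` and
`θ = s x + π/2`), up to `O(1/s)`. -/
lemma DelayData.abs_integral_sub_le (h : DelayData Q D M) (hs1 : 1 ≤ s) (hs : 2 * π * M ≤ s)
    (hY : IsVolterra Q D a b s Y) (θ : ℝ) {x : ℝ} (hx : x ∈ Icc 0 π) :
    |(∫ τ in (0 : ℝ)..x, Q τ * Y (D τ) * sin (θ - s * τ))
      - a * (sin θ * L Q (fun τ => τ - D τ) x s - cos θ * K Q (fun τ => τ - D τ) x s)|
      ≤ (M * (|b| + M * (2 * (|a| + |b|)) * π) * π + |a| * M) / s := by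
  have hs0 : 0 < s := by linarith
  have hYc := hY.cont
  have h1 := h.abs_integral_mul_le (Y := fun x => Y x - a * cos (s * x))
    (h.abs_sub_cos_le_of_isVolterra hs1 hs hY)
    (w := fun τ => sin (θ - s * τ)) (W := 1) (fun τ _ => abs_sin_le_one _) hx
  have h2 := h.osc s hs0 θ x hx
  have e : (∫ τ in (0 : ℝ)..x, Q τ * Y (D τ) * sin (θ - s * τ))
      - a * (sin θ * L Q (fun τ => τ - D τ) x s - cos θ * K Q (fun τ => τ - D τ) x s)
      = (∫ τ in (0 : ℝ)..x, Q τ * (fun x => Y x - a * cos (s * x)) (D τ) * sin (θ - s * τ))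
        + a * (1 / 2 * ∫ τ in (0 : ℝ)..x, Q τ * sin (θ - s * (τ + D τ))) := by
    have e1 : (∫ τ in (0 : ℝ)..x, Q τ * (fun x => Y x - a * cos (s * x)) (D τ)
          * sin (θ - s * τ))
        = (∫ τ in (0 : ℝ)..x, Q τ * Y (D τ) * sin (θ - s * τ))
          - a * ∫ τ in (0 : ℝ)..x, Q τ * cos (s * D τ) * sin (θ - s * τ) := by
      rw [← intervalIntegral.integral_const_mul, ← intervalIntegral.integral_sub
        (h.intervalIntegrable hYc (by fun_prop) _ _)
        ((h.intervalIntegrable (Y := fun x => cos (s * x)) (by fun_prop)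
          (by fun_prop) _ _).const_mul a)]
      refine intervalIntegral.integral_congr fun τ _ => ?_
      simp only
      ring
    rw [e1, h.integral_mul_cos_eq]
    ring
  rw [e]
  refine (abs_add_le _ _).trans ?_
  have h3 : |a * (1 / 2 * ∫ τ in (0 : ℝ)..x, Q τ * sin (θ - s * (τ + D τ)))| ≤ |a| * (M / s) := by
    rw [abs_mul, abs_mul, abs_of_pos (by norm_num : (0 : ℝ) < 1 / 2)]
    refine mul_le_mul_of_nonneg_left ?_ (abs_nonneg _)
    linarith [abs_nonneg (∫ τ in (0 : ℝ)..x, Q τ * sin (θ - s * (τ + D τ)))]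
  refine (add_le_add h1 h3).trans (le_of_eq ?_)
  ring

end

/-! ### Zeros of a bounded Lipschitz perturbation of `s sin πs` -/

lemma two_mul_abs_le_abs_sin {h : ℝ} (hh : |h| ≤ 1 / 2) : 2 * |h| ≤ |sin (h * π)| := by
  have h1 : 2 / π * (|h| * π) ≤ sin (|h| * π) :=
    mul_le_sin (by positivity) (by nlinarith [pi_pos])
  have h2 : 2 / π * (|h| * π) = 2 * |h| := by field_simp
  have h3 : |sin (h * π)| = |sin (|h| * π)| := by
    rcases abs_cases h with ⟨e, _⟩ | ⟨e, _⟩ <;> simp [e]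
  rw [h3, ← h2]
  exact h1.trans (le_abs_self _)

/-- Near `0` the function `h ↦ sin πh` is expanding. -/
lemma abs_sub_le_abs_sin_sub {h k : ℝ} (hh : |h| ≤ 1 / 4) (hk : |k| ≤ 1 / 4) :
    |h - k| ≤ |sin (h * π) - sin (k * π)| := by
  have e1 : (h * π - k * π) / 2 = ((h - k) / 2) * π := by ring
  have h1 : 2 * |(h - k) / 2| ≤ |sin (((h - k) / 2) * π)| := two_mul_abs_le_abs_sin <| by
    have := abs_sub h k
    rw [abs_div, abs_two]
    linarith
  have h2 : 1 / 2 ≤ cos ((h * π + k * π) / 2) := by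
    have h3 : |(h * π + k * π) / 2| ≤ 1 := by
      have e : (h * π + k * π) / 2 = (h + k) * (π / 2) := by ring
      have h4 := abs_add_le h k
      rw [e, abs_mul, abs_of_pos (by positivity : 0 < π / 2)]
      nlinarith [pi_lt_four, pi_pos]
    have h5 := one_sub_sq_div_two_le_cos (x := (h * π + k * π) / 2)
    have h6 := (sq_le_one_iff_abs_le_one _).2 h3
    linarith
  rw [sin_sub_sin, e1, abs_mul, abs_mul, abs_two, abs_of_nonneg (by linarith : 0 ≤ cos _)]
  rw [abs_div, abs_two] at h1
  nlinarith [abs_nonneg (h - k), abs_nonneg (sin (((h - k) / 2) * π))]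

lemma sin_mul_pi_eq (n : ℕ) (s : ℝ) : sin (s * π) = (-1) ^ n * sin ((s - n) * π) := by
  rw [sub_mul, sin_sub_nat_mul_pi, ← mul_assoc, ← mul_pow]
  simp

lemma cos_mul_pi_eq (n : ℕ) (s : ℝ) : cos (s * π) = (-1) ^ n * cos ((s - n) * π) := by
  rw [sub_mul, cos_sub_nat_mul_pi, ← mul_assoc, ← mul_pow]
  simp

/-- If `R` is bounded and Lipschitz, then for large `n` the equation `s A sin πs = R s` has exactly
one solution within `1/2` of `n`, and it is `O(1/n)`-close to `n`. -/
lemma exists_unique_zero_near {R : ℝ → ℝ} {A C s₀ : ℝ} (hA : A ≠ 0)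
    (hR : ∀ s ≥ s₀, |R s| ≤ C) (hL : ∀ s ≥ s₀, ∀ t ≥ s₀, |R s - R t| ≤ C * |s - t|) :
    ∃ (N : ℕ) (c : ℝ), ∀ n : ℕ, N ≤ n → ∃ s : ℝ, |s - n| ≤ 1 / 2 ∧ |s - n| ≤ c / n ∧
      s * (A * sin (s * π)) = R s ∧
      ∀ t : ℝ, |t - n| ≤ 1 / 2 → t * (A * sin (t * π)) = R t → t = s := by
  have hC0 : 0 ≤ C := (abs_nonneg _).trans (hR s₀ le_rfl)
  set c := C / |A| with hc
  have hc0 : 0 ≤ c := by positivity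
  obtain ⟨N, hN⟩ := exists_nat_gt (max (4 * c + 4) (2 * s₀))
  refine ⟨N, c, fun n hn => ?_⟩
  have hnN : (N : ℝ) ≤ n := by exact_mod_cast hn
  have hn1 : 4 * c + 4 < n := (le_max_left _ _).trans_lt (hN.trans_le hnN)
  have hn2 : 2 * s₀ < n := (le_max_right _ _).trans_lt (hN.trans_le hnN)
  have hε : ((-1 : ℝ) ^ n) * (-1) ^ n = 1 := by rw [← mul_pow]; simp
  have hεa : |(-1 : ℝ) ^ n| = 1 := by simp
  let ρ : ℝ → ℝ := fun s => (-1) ^ n * R s / A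
  have hρ : ∀ s ≥ s₀, |ρ s| ≤ c := fun s hs => by
    simp only [ρ]
    rw [abs_div, abs_mul, hεa, one_mul]
    exact div_le_div_of_nonneg_right (hR s hs) (abs_nonneg _)
  have hρL : ∀ s ≥ s₀, ∀ t ≥ s₀, |ρ s - ρ t| ≤ c * |s - t| := fun s hs t ht => by
    simp only [ρ]
    rw [← sub_div, ← mul_sub, abs_div, abs_mul, hεa, one_mul, hc, div_mul_eq_mul_div]
    exact div_le_div_of_nonneg_right (hL s hs t ht) (abs_nonneg _)
  have heq : ∀ s, s * (A * sin (s * π)) = R s ↔ s * sin ((s - n) * π) = ρ s := fun s => by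
    simp only [ρ]
    rw [sin_mul_pi_eq n s, eq_div_iff hA]
    constructor
    · intro h
      linear_combination (-1) ^ n * h - s * A * sin ((s - n) * π) * hε
    · intro h
      linear_combination (-1) ^ n * h + R s * hε
  simp only [heq]
  have hbig : ∀ t : ℝ, |t - n| ≤ 1 / 2 → s₀ ≤ t ∧ (n : ℝ) / 2 ≤ t := fun t ht => by
    have := (abs_le.1 ht).1
    constructor <;> linarith
  have hnpos : (0 : ℝ) < n := by linarith
  have hloc : ∀ t : ℝ, |t - n| ≤ 1 / 2 → t * sin ((t - n) * π) = ρ t → |t - n| ≤ c / n := by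
    intro t ht h
    obtain ⟨h1, h2⟩ := hbig t ht
    have h3 := two_mul_abs_le_abs_sin ht
    have h4 := hρ t h1
    rw [← h, abs_mul, abs_of_pos (by linarith : 0 < t)] at h4
    rw [le_div_iff₀ hnpos]
    nlinarith [abs_nonneg (t - n)]
  have hex : ∃ s : ℝ, |s - n| ≤ 1 / 2 ∧ s * sin ((s - n) * π) = ρ s := by
    have hρc : ContinuousOn ρ (Icc (n - 1 / 2 : ℝ) (n + 1 / 2)) := by
      refine (LipschitzOnWith.of_dist_le_mul (K := c.toNNReal) fun s hs t ht => ?_).continuousOn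
      rw [Real.coe_toNNReal _ hc0]
      exact hρL s (by linarith [hs.1]) t (by linarith [ht.1])
    have hg : ContinuousOn (fun s => s * sin ((s - n) * π) - ρ s)
        (Icc (n - 1 / 2 : ℝ) (n + 1 / 2)) :=
      ContinuousOn.sub (by fun_prop) hρc
    have h0 := intermediate_value_Icc (by linarith) hg
    have hlo := (abs_le.1 (hρ (n - 1 / 2) (by linarith))).1
    have hhi := (abs_le.1 (hρ (n + 1 / 2) (by linarith))).2
    have hsl : sin (((n : ℝ) - 1 / 2 - n) * π) = -1 := by
      rw [show ((n : ℝ) - 1 / 2 - n) * π = -(π / 2) by ring, sin_neg, sin_pi_div_two]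
    have hsr : sin (((n : ℝ) + 1 / 2 - n) * π) = 1 := by
      rw [show ((n : ℝ) + 1 / 2 - n) * π = π / 2 by ring, sin_pi_div_two]
    have hmem : (0 : ℝ) ∈ Icc ((n - 1 / 2 : ℝ) * sin (((n : ℝ) - 1 / 2 - n) * π) - ρ (n - 1 / 2))
        ((n + 1 / 2 : ℝ) * sin (((n : ℝ) + 1 / 2 - n) * π) - ρ (n + 1 / 2)) :=
      ⟨by rw [hsl]; linarith, by rw [hsr]; linarith⟩
    obtain ⟨s, hs, hs0⟩ := h0 hmem
    exact ⟨s, abs_le.2 ⟨by linarith [hs.1], by linarith [hs.2]⟩, sub_eq_zero.1 hs0⟩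
  obtain ⟨s, hs, hs0⟩ := hex
  refine ⟨s, hs, hloc s hs hs0, hs0, fun t ht ht0 => ?_⟩
  have hq : c / n ≤ 1 / 4 := by rw [div_le_iff₀ hnpos]; linarith
  have h1 := abs_sub_le_abs_sin_sub ((hloc t ht ht0).trans hq) ((hloc s hs hs0).trans hq)
  have h2 := hρL t (hbig t ht).1 s (hbig s hs).1
  have e : ρ t - ρ s = (t - s) * sin ((t - n) * π)
      + s * (sin ((t - n) * π) - sin ((s - n) * π)) := by
    rw [← ht0, ← hs0]; ring
  rw [sub_sub_sub_cancel_right] at h1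
  have h3 : s * |t - s| ≤ (c + 1) * |t - s| := by
    have h4 : |s * (sin ((t - n) * π) - sin ((s - n) * π))|
        ≤ |ρ t - ρ s| + |(t - s) * sin ((t - n) * π)| := by
      rw [show s * (sin ((t - n) * π) - sin ((s - n) * π))
        = (ρ t - ρ s) - (t - s) * sin ((t - n) * π) by rw [e]; ring]
      exact abs_sub _ _
    have hspos : 0 < s := by linarith [(hbig s hs).2]
    rw [abs_mul, abs_of_pos hspos, abs_mul (t - s)] at h4
    have h5 := mul_le_mul_of_nonneg_left h1 hspos.le
    have h6 := mul_le_of_le_one_right (abs_nonneg (t - s)) (abs_sin_le_one ((t - n) * π))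
    linarith
  by_contra hne
  have h7 : 0 < |t - s| := abs_pos.2 (sub_ne_zero.2 hne)
  have h8 := le_of_mul_le_mul_right h3 h7
  linarith [(hbig s hs).2]

/-- Second-order expansion of a root of `s sin πs = G cos πs - κ sin πs + O(1/s)`. Here `G'` is the
value at `n` of the coefficient that equals `G` at `s`. -/
lemma abs_shift_sub_le {n : ℕ} {s c C₁ C₂ G G' κ : ℝ} (hn : 1 ≤ n) (hh : |s - n| ≤ 1 / 2)
    (hc : |s - n| ≤ c / n) (hG : |G| ≤ C₁) (hκ : |κ| ≤ C₁) (hGG : |G - G'| ≤ C₁ * |s - n|)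
    (he : |s * sin (s * π) - (G * cos (s * π) - κ * sin (s * π))| ≤ C₂ / s) :
    |(s - n) - G' / (n * π)|
      ≤ (π * c ^ 2 + 2 * π ^ 3 * c ^ 3 + C₁ * π ^ 2 * c ^ 2 + C₁ * π * c + 2 * C₂ + C₁ * c)
        / n ^ 2 := by
  have hn1 : (1 : ℝ) ≤ n := by exact_mod_cast hn
  have hn0 : (0 : ℝ) < n := by linarith
  have hs2 : (n : ℝ) / 2 ≤ s := by linarith [(abs_le.1 hh).1]
  have hs3 : s ≤ 2 * n := by linarith [(abs_le.1 hh).2]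
  have hs0 : 0 < s := by linarith
  have hC₁ : 0 ≤ C₁ := (abs_nonneg _).trans hG
  have hC₂ : 0 ≤ C₂ := by
    have := (abs_nonneg _).trans he
    rwa [le_div_iff₀ hs0, zero_mul] at this
  set h := s - n with hdef
  have hc0 : 0 ≤ c := by
    have := (abs_nonneg _).trans hc
    rwa [le_div_iff₀ hn0, zero_mul] at this
  have hh2 : |h| ^ 2 ≤ c ^ 2 / n := by
    calc |h| ^ 2 ≤ (c / n) ^ 2 := by gcongr
      _ = c ^ 2 / n / n := by ring
      _ ≤ c ^ 2 / n := div_le_self (by positivity) hn1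
  have hh3 : n * |h| ^ 3 ≤ c ^ 3 / n := by
    calc n * |h| ^ 3 ≤ n * (c / n) ^ 3 := by gcongr
      _ = c ^ 3 / n / n := by field_simp
      _ ≤ c ^ 3 / n := div_le_self (by positivity) hn1
  have t1 : |n * π * h - s * π * h| ≤ π * (c ^ 2 / n) := by
    rw [show n * π * h - s * π * h = -(π * h ^ 2) by rw [hdef]; ring, abs_neg, abs_mul,
      abs_of_pos pi_pos, abs_pow]
    gcongr
  have t2 : |s * (h * π - sin (h * π))| ≤ 2 * π ^ 3 * (c ^ 3 / n) := by
    rw [abs_mul, abs_of_pos hs0]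
    have h1 := abs_sub_sin_le (h * π)
    rw [abs_mul, abs_of_pos pi_pos, mul_pow] at h1
    calc s * |h * π - sin (h * π)| ≤ (2 * n) * (|h| ^ 3 * π ^ 3 / 6) := by gcongr
      _ = (n * |h| ^ 3) * (π ^ 3 / 3) := by ring
      _ ≤ (c ^ 3 / n) * (2 * π ^ 3) := by
        gcongr
        have : 0 < π ^ 3 := by positivity
        linarith
      _ = 2 * π ^ 3 * (c ^ 3 / n) := by ring
  have t3 : |G * (cos (h * π) - 1)| ≤ C₁ * π ^ 2 * (c ^ 2 / n) := by
    rw [abs_mul, mul_assoc]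
    refine mul_le_mul hG ?_ (abs_nonneg _) hC₁
    rw [abs_sub_comm, abs_of_nonneg (by linarith [cos_le_one (h * π)])]
    have h1 := one_sub_sq_div_two_le_cos (x := h * π)
    have h2 : (h * π) ^ 2 ≤ π ^ 2 * (c ^ 2 / n) := by
      rw [mul_pow, ← sq_abs h, mul_comm]; gcongr
    linarith [sq_nonneg (h * π)]
  have t4 : |κ * sin (h * π)| ≤ C₁ * π * (c / n) := by
    rw [abs_mul, mul_assoc]
    refine mul_le_mul hκ (abs_sin_le_abs.trans ?_) (abs_nonneg _) hC₁
    rw [abs_mul, abs_of_pos pi_pos, mul_comm]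
    gcongr
  have t5 : |s * sin (h * π) - (G * cos (h * π) - κ * sin (h * π))| ≤ 2 * C₂ / n := by
    have e : s * sin (s * π) - (G * cos (s * π) - κ * sin (s * π))
        = (-1) ^ n * (s * sin (h * π) - (G * cos (h * π) - κ * sin (h * π))) := by
      rw [sin_mul_pi_eq n s, cos_mul_pi_eq n s]; ring
    rw [e, abs_mul, abs_pow, abs_neg, abs_one, one_pow, one_mul] at he
    refine he.trans ?_
    rw [div_le_div_iff₀ hs0 hn0]
    nlinarith
  have t6 : |G - G'| ≤ C₁ * (c / n) := hGG.trans (by gcongr)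
  have e : h - G' / (n * π) = ((n * π * h - s * π * h) + s * (h * π - sin (h * π))
      + (s * sin (h * π) - (G * cos (h * π) - κ * sin (h * π)))
      + G * (cos (h * π) - 1) - κ * sin (h * π) + (G - G')) / (n * π) := by
    field_simp
    ring
  rw [e, abs_div, abs_of_pos (by positivity : 0 < n * π), div_le_iff₀ (by positivity)]
  have hX : |(n * π * h - s * π * h) + s * (h * π - sin (h * π))
      + (s * sin (h * π) - (G * cos (h * π) - κ * sin (h * π)))
      + G * (cos (h * π) - 1) - κ * sin (h * π) + (G - G')|
      ≤ (π * c ^ 2 + 2 * π ^ 3 * c ^ 3 + C₁ * π ^ 2 * c ^ 2 + C₁ * π * c + 2 * C₂ + C₁ * c)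
        / n := by
    refine (abs_add_le _ _).trans ((add_le_add ((abs_sub _ _).trans (add_le_add
      ((abs_add_le _ _).trans (add_le_add ((abs_add_le _ _).trans (add_le_add
        ((abs_add_le _ _).trans (add_le_add t1 t2)) t5)) t3)) t4)) t6).trans (le_of_eq ?_))
    ring
  refine hX.trans ?_
  have e2 : ∀ X : ℝ, X / n ^ 2 * (n * π) = X / n * π := fun X => by field_simp
  rw [e2]
  exact le_mul_of_one_le_right (by positivity) (by linarith [pi_gt_three])

/-! ### Replacing the root by an integer in the expansion of the solution -/

/-- First-order Taylor expansion of `s ↦ cos (s x)` at `n`. -/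
lemma abs_cos_mul_taylor_le {n s c x : ℝ} (hn1 : 1 ≤ n) (hc : |s - n| ≤ c / n)
    (hx : x ∈ Icc 0 π) :
    |cos (s * x) - cos (n * x) + (s - n) * x * sin (n * x)|
      ≤ ((c * π) ^ 2 + (c * π) ^ 3) / n ^ 2 := by
  have hn0 : 0 < n := by linarith
  have hu : |(s - n) * x| ≤ c * π / n := by
    rw [abs_mul, mul_div_right_comm]
    exact mul_le_mul hc (abs_le_pi hx) (abs_nonneg _) ((abs_nonneg _).trans hc)
  have hc0 : 0 ≤ c * π := by
    have := (abs_nonneg _).trans hu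
    rwa [le_div_iff₀ hn0, zero_mul] at this
  set u := (s - n) * x with hudef
  have e : cos (s * x) - cos (n * x) + u * sin (n * x)
      = cos (n * x) * (cos u - 1) + sin (n * x) * (u - sin u) := by
    rw [show s * x = n * x + u by rw [hudef]; ring, cos_add]; ring
  have h2 : u ^ 2 ≤ (c * π) ^ 2 / n ^ 2 := by
    rw [← sq_abs, ← div_pow]; gcongr
  have h3 : |u| ^ 3 ≤ (c * π) ^ 3 / n ^ 2 := by
    calc |u| ^ 3 ≤ (c * π / n) ^ 3 := by gcongr
      _ = (c * π) ^ 3 / n ^ 2 / n := by field_simp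
      _ ≤ (c * π) ^ 3 / n ^ 2 := div_le_self (by positivity) hn1
  have t1 : |cos (n * x) * (cos u - 1)| ≤ (c * π) ^ 2 / n ^ 2 := by
    rw [abs_mul]
    refine (mul_le_of_le_one_left (abs_nonneg _) (abs_cos_le_one _)).trans ?_
    rw [abs_sub_comm, abs_of_nonneg (by linarith [cos_le_one u])]
    linarith [one_sub_sq_div_two_le_cos (x := u), sq_nonneg u]
  have t2 : |sin (n * x) * (u - sin u)| ≤ (c * π) ^ 3 / n ^ 2 := by
    rw [abs_mul]
    refine (mul_le_of_le_one_left (abs_nonneg _) (abs_sin_le_one _)).trans ?_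
    have := pow_nonneg (abs_nonneg u) 3
    linarith [abs_sub_sin_le u]
  rw [e, add_div]
  exact (abs_add_le _ _).trans (add_le_add t1 t2)

lemma abs_mul_div_sub_le {n s c C f f' g g' : ℝ} (hn0 : 0 < n) (hs : n / 2 ≤ s)
    (hc : |s - n| ≤ c / n) (hf' : |f'| ≤ 1) (hff : |f - f'| ≤ π * |s - n|)
    (hg : |g| ≤ C) (hg' : |g'| ≤ C) (hgg : |g - g'| ≤ C * |s - n|) (hn1 : 1 ≤ n) :
    |f * g / s - f' * g' / n| ≤ 2 * C * (π + 2) * c / n ^ 2 := by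
  have hs0 : 0 < s := by linarith
  have hC : 0 ≤ C := (abs_nonneg _).trans hg
  have e : f * g / s - f' * g' / n
      = ((f - f') * g + f' * (g - g') - f' * g' * (s - n) / n) / s := by
    field_simp
    ring
  have t1 : |(f - f') * g| ≤ π * |s - n| * C := by
    rw [abs_mul]
    exact mul_le_mul hff hg (abs_nonneg _) (by positivity)
  have t2 : |f' * (g - g')| ≤ C * |s - n| := by
    rw [abs_mul]
    exact (mul_le_of_le_one_left (abs_nonneg _) hf').trans hgg
  have t3 : |f' * g' * (s - n) / n| ≤ C * |s - n| := by
    rw [abs_div, abs_of_pos hn0, abs_mul, abs_mul]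
    refine (div_le_self (by positivity) hn1).trans ?_
    gcongr
    exact (mul_le_of_le_one_left (abs_nonneg _) hf').trans hg'
  rw [e, abs_div, abs_of_pos hs0, div_le_iff₀ hs0]
  have h1 := (abs_sub _ _).trans (add_le_add ((abs_add_le _ _).trans (add_le_add t1 t2)) t3)
  refine h1.trans ?_
  calc π * |s - n| * C + C * |s - n| + C * |s - n| = C * (π + 2) * |s - n| := by ring
    _ ≤ C * (π + 2) * (c / n) := by gcongr
    _ = 2 * C * (π + 2) * c / n ^ 2 * (n / 2) := by field_simp
    _ ≤ 2 * C * (π + 2) * c / n ^ 2 * s := by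
      have hc0 : 0 ≤ c := by
        have := (abs_nonneg _).trans hc
        rwa [le_div_iff₀ hn0, zero_mul] at this
      gcongr

/-- If `z` is close to `w` and `s` is close to `n`, then `z / s^(2/3)` is close to
`w / n^(2/3)`. -/
lemma abs_div_rpow_sub_le {n s c C C' z w δ : ℝ} (hn1 : 1 ≤ n) (hs1 : 1 ≤ s) (hδ : δ ≠ 0)
    (hc : |s - n| ≤ c / n) (hz : |z| ≤ C') (hzw : |z - w| ≤ C / n ^ 2) :
    |z / (s ^ (2 / 3 : ℝ) * δ) - w / (n ^ (2 / 3 : ℝ) * δ)| ≤ (C' * c + C) / |δ| / n ^ 2 := by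
  have hn0 : 0 < n := by linarith
  have hs0 : 0 < s := by linarith
  have hnp : 1 ≤ n ^ (2 / 3 : ℝ) := one_le_rpow hn1 (by norm_num)
  have hsp : 1 ≤ s ^ (2 / 3 : ℝ) := one_le_rpow hs1 (by norm_num)
  set p := n ^ (2 / 3 : ℝ) with hp
  set r := s ^ (2 / 3 : ℝ) with hr
  have hδ' : 0 < |δ| := abs_pos.2 hδ
  -- concavity of the power in the form `|v^(2/3) - 1| ≤ |v - 1|`, at `v = s / n`
  have h1 : |r / p - 1| ≤ |s / n - 1| := by
    rw [hp, hr, ← div_rpow hs0.le hn0.le]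
    rcases le_total 1 (s / n) with hv | hv
    · have h2 := one_le_rpow hv (by norm_num : (0 : ℝ) ≤ 2 / 3)
      have h3 : (s / n) ^ (2 / 3 : ℝ) ≤ (s / n) ^ (1 : ℝ) :=
        rpow_le_rpow_of_exponent_le hv (by norm_num)
      rw [rpow_one] at h3
      rw [abs_of_nonneg (by linarith), abs_of_nonneg (by linarith)]
      linarith
    · have hv0 : 0 < s / n := by positivity
      have h2 := rpow_le_one hv0.le hv (by norm_num : (0 : ℝ) ≤ 2 / 3)
      have h3 : (s / n) ^ (1 : ℝ) ≤ (s / n) ^ (2 / 3 : ℝ) :=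
        rpow_le_rpow_of_exponent_ge hv0 hv (by norm_num)
      rw [rpow_one] at h3
      rw [abs_of_nonpos (by linarith), abs_of_nonpos (by linarith)]
      linarith
  have h4 : |s / n - 1| ≤ c / n ^ 2 := by
    rw [show s / n - 1 = (s - n) / n by field_simp, abs_div, abs_of_pos hn0,
      div_le_iff₀ hn0]
    refine hc.trans (le_of_eq ?_)
    field_simp
  have e : z / (r * δ) - w / (p * δ) = (z - w) / (p * δ) - z * (r / p - 1) / (r * δ) := by
    field_simp
    ring
  have t1 : |(z - w) / (p * δ)| ≤ C / |δ| / n ^ 2 := by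
    rw [abs_div, abs_mul, abs_of_pos (by linarith : 0 < p), ← div_div, div_right_comm]
    calc |z - w| / |δ| / p ≤ |z - w| / |δ| := div_le_self (by positivity) hnp
      _ ≤ C / n ^ 2 / |δ| := by gcongr
      _ = C / |δ| / n ^ 2 := by ring
  have t2 : |z * (r / p - 1) / (r * δ)| ≤ C' * c / |δ| / n ^ 2 := by
    rw [abs_div, abs_mul, abs_mul, abs_of_pos (by linarith : 0 < r), ← div_div, div_right_comm]
    have hC' : 0 ≤ C' := (abs_nonneg _).trans hz
    calc |z| * |r / p - 1| / |δ| / r ≤ |z| * |r / p - 1| / |δ| :=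
          div_le_self (by positivity) hsp
      _ ≤ C' * (c / n ^ 2) / |δ| := by
          gcongr
          exact h1.trans h4
      _ = C' * c / |δ| / n ^ 2 := by ring
  rw [e]
  refine (abs_sub _ _).trans ((add_le_add t1 t2).trans (le_of_eq ?_))
  ring

/-! ### The coefficients on the whole line -/

lemma clamp_mem_dom {t : ℝ} (ht : t ≠ π / 2) : clamp t ∈ dom := by
  have hpi := pi_pos
  rcases lt_or_gt_of_ne ht with h | h
  · exact Or.inl ⟨le_max_left _ _,
      max_lt (by linarith) ((min_le_left _ _).trans_lt h)⟩
  · exact Or.inr ⟨lt_max_of_lt_right (lt_min h (by linarith)), (clamp_mem t).2⟩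

lemma dom_subset_Icc : dom ⊆ Icc 0 π := by
  have hpi := pi_pos
  rintro x (hx | hx)
  · exact ⟨hx.1, by linarith [hx.2]⟩
  · exact ⟨by linarith [hx.1], hx.2⟩

lemma mem_dom {x : ℝ} (hx : x ∈ Icc 0 π) (hne : x ≠ π / 2) : x ∈ dom := by
  rw [← clamp_of_mem hx]; exact clamp_mem_dom hne

lemma ne_of_mem_dom {x : ℝ} (hx : x ∈ dom) : x ≠ π / 2 := by
  rcases hx with hx | hx
  · exact hx.2.ne
  · exact hx.1.ne'

/-- The potential, extended to the line by its boundary values. -/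
noncomputable def extPotential (q : ℝ → ℝ) (t : ℝ) : ℝ := q (clamp t)

/-- The retarded argument `x - Δ x`, extended to the line; the outer projection only acts at the
transmission point, where `Δ` is unconstrained. -/
noncomputable def extDelayed (Δ : ℝ → ℝ) (t : ℝ) : ℝ := clamp (clamp t - Δ (clamp t))

section

variable {q Δ : ℝ → ℝ}

lemma extPotential_of_mem {t : ℝ} (ht : t ∈ Icc 0 π) : extPotential q t = q t := by
  rw [extPotential, clamp_of_mem ht]

lemma Admissible.sub_mem (h : Admissible q Δ) {t : ℝ} (ht : t ∈ dom) : t - Δ t ∈ Icc 0 π := by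
  have h1 := h.delay_nonneg t ht
  have h2 := (dom_subset_Icc ht).2
  refine ⟨?_, by linarith⟩
  rcases ht with ht | ht
  · exact h.delay_left t ht
  · linarith [h.delay_right t ht, pi_pos]

lemma Admissible.extDelayed_of_mem (h : Admissible q Δ) {t : ℝ} (ht : t ∈ dom) :
    extDelayed Δ t = t - Δ t := by
  rw [extDelayed, clamp_of_mem (dom_subset_Icc ht), clamp_of_mem (h.sub_mem ht)]

lemma Admissible.continuousOn_extPotential (h : Admissible q Δ) :
    ContinuousOn (extPotential q) {π / 2}ᶜ :=
  h.q_cont.comp continuous_clamp.continuousOn fun _ ht => clamp_mem_dom ht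

lemma Admissible.continuousOn_extDelayed (h : Admissible q Δ) :
    ContinuousOn (extDelayed Δ) {π / 2}ᶜ :=
  continuous_clamp.comp_continuousOn (continuous_clamp.continuousOn.sub
    (h.delay_cont.comp continuous_clamp.continuousOn fun _ ht => clamp_mem_dom ht))

lemma CondA.exists_bound (h : CondA q Δ) : ∃ M, ∀ x ∈ Icc 0 π, |q x| ≤ M := by
  have hpi := pi_pos
  obtain ⟨M, hM⟩ := h.q_bdd
  have h0 : (0 : ℝ) ∈ Ico 0 (π / 2) := ⟨le_rfl, by linarith⟩
  have hπ : π ∈ Ioc (π / 2) π := ⟨by linarith, le_rfl⟩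
  have hM0 : 0 ≤ M := (abs_nonneg _).trans (hM 0 (Or.inl h0))
  have hd : ∀ x ∈ dom, HasDerivWithinAt q (derivWithin q dom x) dom x :=
    fun x hx => (h.q_diff x hx).hasDerivWithinAt
  refine ⟨|q 0| + |q π| + |q (π / 2)| + M * π, fun x hx => ?_⟩
  have n1 := abs_nonneg (q 0)
  have n2 := abs_nonneg (q π)
  have n3 := abs_nonneg (q (π / 2))
  have n4 : 0 ≤ M * π := by positivity
  by_cases hne : x = π / 2
  · subst hne; linarith
  have aux : ∀ (S : Set ℝ) (y : ℝ), S ⊆ dom → Convex ℝ S → x ∈ S → y ∈ S →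
      |q x| ≤ |q y| + M * π := by
    intro S y hS hconv hxS hyS
    have h1 := hconv.norm_image_sub_le_of_norm_hasDerivWithin_le
      (fun z hz => (hd z (hS hz)).mono hS) (fun z hz => hM z (hS hz)) hyS hxS
    rw [Real.norm_eq_abs, Real.norm_eq_abs] at h1
    have h2 : |q x| ≤ |q y| + |q x - q y| := by
      simpa using abs_add_le (q y) (q x - q y)
    have h3 := mul_le_mul_of_nonneg_left (abs_sub_le_pi hx (dom_subset_Icc (hS hyS))) hM0
    linarith
  rcases mem_dom hx hne with hx' | hx'
  · linarith [aux _ _ subset_union_left (convex_Ico _ _) hx' h0]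
  · linarith [aux _ _ subset_union_right (convex_Ioc _ _) hx' hπ]

/-- Nonstationary phase: since `2 - Δ' ≥ 1`, the phase `2x - Δ x` can be integrated by parts once.
The boundary term is `p cos (θ - s (2x - Δ x)) / s` with `p = q / (2 - Δ')`; as nothing is known
about the integrability of `p'`, the remainder is estimated by the mean value inequality. -/
lemma abs_sub_le_of_nonstationary (ha : CondA q Δ) (hb : CondB Δ) {M₀ M₁ M₂ : ℝ}
    (h0 : ∀ x ∈ dom, |q x| ≤ M₀) (h1 : ∀ x ∈ dom, |derivWithin q dom x| ≤ M₁)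
    (h2 : ∀ x ∈ dom, |derivWithin (derivWithin Δ dom) dom x| ≤ M₂) {s θ u v : ℝ} (hs : 0 < s)
    (huv : u ≤ v) (hsub : Icc u v ⊆ dom) {G : ℝ → ℝ}
    (hG : ∀ x ∈ Icc u v, HasDerivAt G (q x * sin (θ - s * (x + (x - Δ x)))) x) :
    |G v - G u| ≤ ((M₁ + M₀ * M₂) * π + 2 * M₀) / s := by
  have hu : u ∈ Icc u v := left_mem_Icc.2 huv
  have hv : v ∈ Icc u v := right_mem_Icc.2 huv
  have hM₀ : 0 ≤ M₀ := (abs_nonneg _).trans (h0 u (hsub hu))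
  have hM₁ : 0 ≤ M₁ := (abs_nonneg _).trans (h1 u (hsub hu))
  have hM₂ : 0 ≤ M₂ := (abs_nonneg _).trans (h2 u (hsub hu))
  let d : ℝ → ℝ := fun x => 2 - derivWithin Δ dom x
  have hd : ∀ x ∈ dom, 1 ≤ d x := fun x hx => by
    have := hb.deriv_le x hx
    simp only [d]; linarith
  let p : ℝ → ℝ := fun x => q x / d x * cos (θ - s * (x + (x - Δ x)))
  let p' : ℝ → ℝ := fun x => (derivWithin q dom x * d x
    + q x * derivWithin (derivWithin Δ dom) dom x) / d x ^ 2 * cos (θ - s * (x + (x - Δ x)))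
  have hp : ∀ x ∈ dom, HasDerivWithinAt p
      (p' x + s * (q x * sin (θ - s * (x + (x - Δ x))))) dom x := by
    intro x hx
    have e1 := (ha.q_diff x hx).hasDerivWithinAt
    have e2 := (ha.delay_diff x hx).hasDerivWithinAt
    have e3 := (ha.delay_diff2 x hx).hasDerivWithinAt
    have hdx : d x ≠ 0 := by have := hd x hx; linarith
    have e4 : HasDerivWithinAt d (-derivWithin (derivWithin Δ dom) dom x) dom x :=
      e3.const_sub 2
    have e5 : HasDerivWithinAt (fun x => θ - s * (x + (x - Δ x))) (-(s * d x)) dom x := by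
      refine ((((hasDerivWithinAt_id x dom).add
        ((hasDerivWithinAt_id x dom).sub e2)).const_mul s).const_sub θ).congr_deriv ?_
      simp only [d]; ring
    refine ((e1.div e4 hdx).mul e5.cos).congr_deriv ?_
    simp only [p', Pi.div_apply]
    field_simp
    ring
  have hpb : ∀ x ∈ dom, |p x| ≤ M₀ := fun x hx => by
    have hdx := hd x hx
    simp only [p]
    rw [abs_mul, abs_div, abs_of_pos (by linarith : 0 < d x)]
    exact (mul_le_of_le_one_right (by positivity) (abs_cos_le_one _)).trans
      ((div_le_self (abs_nonneg _) hdx).trans (h0 x hx))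
  have hp'b : ∀ x ∈ dom, |p' x| ≤ M₁ + M₀ * M₂ := fun x hx => by
    have hdx := hd x hx
    have hd0 : 0 < d x := by linarith
    simp only [p']
    rw [abs_mul, abs_div, abs_of_pos (by positivity : 0 < d x ^ 2)]
    refine (mul_le_of_le_one_right (by positivity) (abs_cos_le_one _)).trans ?_
    rw [div_le_iff₀ (by positivity)]
    have t1 : |derivWithin q dom x * d x| ≤ M₁ * d x ^ 2 := by
      rw [abs_mul, abs_of_pos hd0]
      exact mul_le_mul (h1 x hx) (by nlinarith) hd0.le hM₁
    have t2 : |q x * derivWithin (derivWithin Δ dom) dom x| ≤ M₀ * M₂ * d x ^ 2 := by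
      rw [abs_mul]
      refine (mul_le_mul (h0 x hx) (h2 x hx) (abs_nonneg _) hM₀).trans ?_
      exact le_mul_of_one_le_right (by positivity) (one_le_pow₀ hdx)
    exact (abs_add_le _ _).trans (by linarith)
  have hH : ∀ x ∈ Icc u v, HasDerivWithinAt (fun x => G x - p x / s) (-(p' x / s)) (Icc u v) x := by
    intro x hx
    refine ((hG x hx).hasDerivWithinAt.sub
      (((hp x (hsub hx)).mono hsub).div_const s)).congr_deriv ?_
    field_simp
    ring
  have key := (convex_Icc u v).norm_image_sub_le_of_norm_hasDerivWithin_le hH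
    (C := (M₁ + M₀ * M₂) / s) (fun x hx => by
      rw [Real.norm_eq_abs, abs_neg, abs_div, abs_of_pos hs]
      exact div_le_div_of_nonneg_right (hp'b x (hsub hx)) hs.le) hu hv
  rw [Real.norm_eq_abs, Real.norm_eq_abs] at key
  have hvu : |v - u| ≤ π := abs_sub_le_pi (dom_subset_Icc (hsub hv)) (dom_subset_Icc (hsub hu))
  have k2 : (M₁ + M₀ * M₂) / s * |v - u| ≤ (M₁ + M₀ * M₂) / s * π :=
    mul_le_mul_of_nonneg_left hvu (by positivity)
  have k3 : |(p v - p u) / s| ≤ 2 * M₀ / s := by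
    rw [abs_div, abs_of_pos hs]
    refine div_le_div_of_nonneg_right ((abs_sub _ _).trans ?_) hs.le
    linarith [hpb v (hsub hv), hpb u (hsub hu)]
  have e : G v - G u = (G v - p v / s - (G u - p u / s)) + (p v - p u) / s := by ring
  rw [e]
  refine (abs_add_le _ _).trans ((add_le_add (key.trans k2) k3).trans (le_of_eq ?_))
  ring

/-- The one-sided estimates of the oscillatory integral on the two halves of `[0, π]` extend to
the transmission point by continuity of the primitive. -/
lemma Admissible.exists_delayData (h : Admissible q Δ) (ha : CondA q Δ) (hb : CondB Δ) :
    ∃ M, DelayData (extPotential q) (extDelayed Δ) M := by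
  have hpi := pi_pos
  obtain ⟨M₀, h0⟩ := ha.exists_bound
  obtain ⟨M₁, h1⟩ := ha.q_bdd
  obtain ⟨M₂, h2⟩ := ha.delay_bdd
  have m0 : (0 : ℝ) ∈ dom := Or.inl ⟨le_rfl, by linarith⟩
  have hM₀ : 0 ≤ M₀ := (abs_nonneg _).trans (h0 0 (dom_subset_Icc m0))
  have hM₁ : 0 ≤ M₁ := (abs_nonneg _).trans (h1 0 m0)
  have hM₂ : 0 ≤ M₂ := (abs_nonneg _).trans (h2 0 m0)
  have hQ : ∀ x, |extPotential q x| ≤ M₀ := fun x => h0 _ (clamp_mem x)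
  set C := (M₁ + M₀ * M₂) * π + 2 * M₀ with hC
  have hC0 : 0 ≤ C := by positivity
  refine ⟨2 * C, h.continuousOn_extPotential, h.continuousOn_extDelayed,
    fun x => (hQ x).trans ?_, fun x => clamp_mem _, fun s hs θ x hx => ?_⟩
  · have : 0 ≤ (M₁ + M₀ * M₂) * π := by positivity
    linarith
  let P : ℝ → ℝ := fun τ => extPotential q τ * sin (θ - s * (τ + extDelayed Δ τ))
  have hP : ContinuousOn P {π / 2}ᶜ := by
    have := h.continuousOn_extPotential
    have := h.continuousOn_extDelayed
    fun_prop
  have hPb : ∀ x, |P x| ≤ M₀ := fun x => by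
    simp only [P]
    rw [abs_mul]
    exact (mul_le_of_le_one_right (abs_nonneg _) (abs_sin_le_one _)).trans (hQ x)
  let I : ℝ → ℝ := fun x => ∫ τ in (0 : ℝ)..x, P τ
  have hI : Continuous I :=
    intervalIntegral.continuous_primitive (intervalIntegrable_of_continuousOn_compl hP hPb) 0
  have hI' : ∀ x ∈ dom, HasDerivAt I (q x * sin (θ - s * (x + (x - Δ x)))) x := by
    intro x hx
    have := hasDerivAt_primitive_mul hP hPb (w := fun _ => 1) continuous_const (ne_of_mem_dom hx)
    simp only [mul_one] at this
    refine this.congr_deriv ?_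
    simp only [P]
    rw [extPotential_of_mem (dom_subset_Icc hx), h.extDelayed_of_mem hx]
  have key : ∀ u v, u ≤ v → Icc u v ⊆ dom → |I v - I u| ≤ C / s := fun u v huv hsub =>
    abs_sub_le_of_nonstationary ha hb (fun x hx => h0 x (dom_subset_Icc hx)) h1 h2 hs huv hsub
      fun x hx => hI' x (hsub hx)
  have I0 : I 0 = 0 := intervalIntegral.integral_same
  have hleft : ∀ v ∈ Ico 0 (π / 2), |I v| ≤ C / s := fun v hv => by
    have := key 0 v hv.1 fun y hy => Or.inl ⟨hy.1, hy.2.trans_lt hv.2⟩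
    rwa [I0, sub_zero] at this
  have hmid : |I (π / 2)| ≤ C / s :=
    le_of_tendsto ((hI.abs.tendsto _).mono_left nhdsWithin_le_nhds)
      (Filter.mem_of_superset (Ico_mem_nhdsLT (by linarith : (0 : ℝ) < π / 2)) hleft)
  have hright : ∀ v ∈ Ioc (π / 2) π, |I v - I (π / 2)| ≤ C / s := fun v hv =>
    le_of_tendsto (((continuous_const.sub hI).abs.tendsto (π / 2)).mono_left nhdsWithin_le_nhds)
      (Filter.mem_of_superset (Ioc_mem_nhdsGT hv.1) fun u hu =>
        key u v hu.2 fun y hy => Or.inr ⟨hu.1.trans_le hy.1, hy.2.trans hv.2⟩)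
  have hCs : 0 ≤ C / s := by positivity
  change |I x| ≤ 2 * C / s
  have e2 : 2 * C / s = C / s + C / s := by ring
  rw [e2]
  by_cases hne : x = π / 2
  · rw [hne]; linarith
  rcases mem_dom hx hne with hx' | hx'
  · linarith [hleft x hx']
  · have := abs_add_le (I x - I (π / 2)) (I (π / 2))
    rw [sub_add_cancel] at this
    linarith [hright x hx']

lemma Admissible.K_ext_eq (h : Admissible q Δ) (s : ℝ) {x : ℝ} (hx : x ∈ Icc 0 π) :
    K (extPotential q) (fun τ => τ - extDelayed Δ τ) x s = K q Δ x s := by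
  unfold K
  congr 1
  refine intervalIntegral.integral_congr_ae ?_
  filter_upwards [compl_mem_ae_iff.2 (measure_singleton (π / 2))] with τ hne hτ
  rw [uIoc_of_le hx.1] at hτ
  have hτ' : τ ∈ Icc 0 π := ⟨hτ.1.le, hτ.2.trans hx.2⟩
  rw [extPotential_of_mem hτ', h.extDelayed_of_mem (mem_dom hτ' hne), sub_sub_cancel]

lemma Admissible.L_ext_eq (h : Admissible q Δ) (s : ℝ) {x : ℝ} (hx : x ∈ Icc 0 π) :
    L (extPotential q) (fun τ => τ - extDelayed Δ τ) x s = L q Δ x s := by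
  unfold L
  congr 1
  refine intervalIntegral.integral_congr_ae ?_
  filter_upwards [compl_mem_ae_iff.2 (measure_singleton (π / 2))] with τ hne hτ
  rw [uIoc_of_le hx.1] at hτ
  have hτ' : τ ∈ Icc 0 π := ⟨hτ.1.le, hτ.2.trans hx.2⟩
  rw [extPotential_of_mem hτ', h.extDelayed_of_mem (mem_dom hτ' hne), sub_sub_cancel]

end

/-! ### The boundary value problem and the integral equation -/

/-- Variation of constants on one interval, with a free phase `θ`: for `θ = s x` the right-hand
side at `v = x` is `s y(x)`, and for `θ = s x + π/2` it is `y'(x)`. -/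
lemma variation_of_constants {y y' r : ℝ → ℝ} {u v s : ℝ} (huv : u ≤ v)
    (hy : ContinuousOn y (Icc u v)) (hy' : ContinuousOn y' (Icc u v))
    (d1 : ∀ x ∈ Ioo u v, HasDerivAt y (y' x) x)
    (d2 : ∀ x ∈ Ioo u v, HasDerivAt y' (-(r x + s ^ 2 * y x)) x) (θ : ℝ)
    (hr : IntervalIntegrable (fun τ => r τ * sin (θ - s * τ)) volume u v) :
    y' v * sin (θ - s * v) + s * y v * cos (θ - s * v)
      = y' u * sin (θ - s * u) + s * y u * cos (θ - s * u)
        - ∫ τ in u..v, r τ * sin (θ - s * τ) := by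
  have key := intervalIntegral.integral_eq_sub_of_hasDerivAt_of_le huv
    (f := fun x => y' x * sin (θ - s * x) + s * y x * cos (θ - s * x))
    (f' := fun x => -(r x * sin (θ - s * x))) (by fun_prop) (fun x hx => by
      have e : HasDerivAt (fun x => θ - s * x) (-s) x := by
        simpa using ((hasDerivAt_id x).const_mul s).const_sub θ
      refine (((d2 x hx).mul e.sin).add (((d1 x hx).const_mul s).mul e.cos)).congr_deriv ?_
      ring) hr.neg
  rw [intervalIntegral.integral_neg] at key
  linarith

lemma uniqueDiffOn_left : UniqueDiffOn ℝ left := uniqueDiffOn_Icc pi_div_two_pos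

lemma uniqueDiffOn_right : UniqueDiffOn ℝ right :=
  uniqueDiffOn_Icc (by linarith [pi_pos])

section

variable {q Δ : ℝ → ℝ} {s κ : ℝ} {y₁ y₂ : ℝ → ℝ}

/-- A solution with its second half scaled by the transmission factor `κ` is continuous with
continuous derivative across `π/2`, and so satisfies the integral equation on all of `[0, π]`. -/
lemma Admissible.exists_isVolterra_of_isSolution (h : Admissible q Δ) {M : ℝ}
    (hd : DelayData (extPotential q) (extDelayed Δ) M) (hs : 0 < s)
    (hsol : IsSolution q Δ (s ^ 2) y₁ y₂)
    (ht : y₁ (π / 2) = κ * y₂ (π / 2))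
    (ht' : derivWithin y₁ left (π / 2) = κ * derivWithin y₂ right (π / 2)) :
    ∃ Y, IsVolterra (extPotential q) (extDelayed Δ) (y₁ 0) (derivWithin y₁ left 0) s Y ∧
      (∀ x ∈ left, Y x = y₁ x) ∧ (∀ x ∈ right, Y x = κ * y₂ x) ∧
      κ * derivWithin y₂ right π = -(y₁ 0 * s * sin (s * π)) + derivWithin y₁ left 0 * cos (s * π)
        - cosConv (fun τ => extPotential q τ * Y (extDelayed Δ τ)) s π := by
  have hpi := pi_pos
  let Y : ℝ → ℝ := fun x =>
    y₁ (max 0 (min x (π / 2))) + κ * (y₂ (max (π / 2) (min x π)) - y₂ (π / 2))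
  have hYc : Continuous Y := by
    have c1 : Continuous fun x => y₁ (max 0 (min x (π / 2))) :=
      hsol.diff₁.continuousOn.comp_continuous (by fun_prop)
        fun x => ⟨le_max_left _ _, max_le (by linarith) (min_le_right _ _)⟩
    have c2 : Continuous fun x => y₂ (max (π / 2) (min x π)) :=
      hsol.diff₂.continuousOn.comp_continuous (by fun_prop)
        fun x => ⟨le_max_left _ _, max_le (by linarith) (min_le_right _ _)⟩
    exact c1.add (continuous_const.mul (c2.sub continuous_const))
  have hYl : ∀ x ∈ left, Y x = y₁ x := fun x hx => by
    simp only [Y]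
    rw [min_eq_left hx.2, max_eq_right hx.1, min_eq_left (by linarith [hx.2]),
      max_eq_left hx.2]
    ring
  have hYr : ∀ x ∈ right, Y x = κ * y₂ x := fun x hx => by
    simp only [Y]
    rw [min_eq_right hx.1, max_eq_right (by linarith), min_eq_left hx.2, max_eq_right hx.1, ht]
    ring
  let P : ℝ → ℝ := fun τ => extPotential q τ * Y (extDelayed Δ τ)
  have hPi : ∀ θ u v, IntervalIntegrable (fun τ => P τ * sin (θ - s * τ)) volume u v :=
    fun θ u v => hd.intervalIntegrable hYc (by fun_prop) u v
  have d1l : ∀ x ∈ Ioo 0 (π / 2), HasDerivAt y₁ (derivWithin y₁ left x) x := fun x hx =>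
    (hsol.diff₁ x ⟨hx.1.le, hx.2.le⟩).hasDerivWithinAt.hasDerivAt (Icc_mem_nhds hx.1 hx.2)
  have d1r : ∀ x ∈ Ioo (π / 2) π, HasDerivAt (fun x => κ * y₂ x)
      (κ * derivWithin y₂ right x) x := fun x hx =>
    ((hsol.diff₂ x ⟨hx.1.le, hx.2.le⟩).hasDerivWithinAt.hasDerivAt
      (Icc_mem_nhds hx.1 hx.2)).const_mul κ
  have d2l : ∀ x ∈ Ioo 0 (π / 2),
      HasDerivAt (derivWithin y₁ left) (-(P x + s ^ 2 * y₁ x)) x := fun x hx => by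
    have hx' : x ∈ Ico 0 (π / 2) := ⟨hx.1.le, hx.2⟩
    have hxd : x ∈ dom := Or.inl hx'
    refine ((hsol.eqn₁ x hx').hasDerivAt (Icc_mem_nhds hx.1 hx.2)).congr_deriv ?_
    simp only [P]
    rw [extPotential_of_mem (dom_subset_Icc hxd), h.extDelayed_of_mem hxd,
      hYl _ ⟨h.delay_left x hx', by linarith [h.delay_nonneg x hxd, hx.2]⟩]
  have d2r : ∀ x ∈ Ioo (π / 2) π, HasDerivAt (fun x => κ * derivWithin y₂ right x)
      (-(P x + s ^ 2 * (κ * y₂ x))) x := fun x hx => by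
    have hx' : x ∈ Ioc (π / 2) π := ⟨hx.1, hx.2.le⟩
    have hxd : x ∈ dom := Or.inr hx'
    refine (((hsol.eqn₂ x hx').hasDerivAt (Icc_mem_nhds hx.1 hx.2)).const_mul κ).congr_deriv ?_
    simp only [P]
    rw [extPotential_of_mem (dom_subset_Icc hxd), h.extDelayed_of_mem hxd,
      hYr _ ⟨h.delay_right x hx', by linarith [h.delay_nonneg x hxd, hx.2]⟩]
    ring
  have wl : ∀ θ, ∀ x ∈ left, derivWithin y₁ left x * sin (θ - s * x)
      + s * y₁ x * cos (θ - s * x) = derivWithin y₁ left 0 * sin θ + s * y₁ 0 * cos θ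
        - ∫ τ in (0 : ℝ)..x, P τ * sin (θ - s * τ) := fun θ x hx => by
    have hsub : Icc 0 x ⊆ left := Icc_subset_Icc_right hx.2
    have := variation_of_constants hx.1 (hsol.diff₁.continuousOn.mono hsub)
      (hsol.cont₁.mono hsub) (fun z hz => d1l z ⟨hz.1, hz.2.trans_le hx.2⟩)
      (fun z hz => d2l z ⟨hz.1, hz.2.trans_le hx.2⟩) θ (hPi θ 0 x)
    simpa using this
  have wr : ∀ θ, ∀ x ∈ right, κ * derivWithin y₂ right x * sin (θ - s * x)
      + s * (κ * y₂ x) * cos (θ - s * x) = derivWithin y₁ left 0 * sin θ + s * y₁ 0 * cos θ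
        - ∫ τ in (0 : ℝ)..x, P τ * sin (θ - s * τ) := fun θ x hx => by
    have hsub : Icc (π / 2) x ⊆ right := Icc_subset_Icc_right hx.2
    have e1 := variation_of_constants (y := fun x => κ * y₂ x)
      (y' := fun x => κ * derivWithin y₂ right x) hx.1
      ((hsol.diff₂.continuousOn.mono hsub).const_mul κ)
      ((hsol.cont₂.mono hsub).const_mul κ) (fun z hz => d1r z ⟨hz.1, hz.2.trans_le hx.2⟩)
      (fun z hz => d2r z ⟨hz.1, hz.2.trans_le hx.2⟩) θ (hPi θ _ x)
    have e2 := wl θ (π / 2) ⟨by linarith, le_rfl⟩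
    rw [ht, ht'] at e2
    have e3 := intervalIntegral.integral_add_adjacent_intervals (hPi θ 0 (π / 2)) (hPi θ (π / 2) x)
    rw [e1, e2, ← e3]
    ring
  refine ⟨Y, ⟨hYc, fun x hx => ?_⟩, hYl, hYr, ?_⟩
  · have e : s * Y x = derivWithin y₁ left 0 * sin (s * x) + s * y₁ 0 * cos (s * x)
        - sinConv P s x := by
      rcases le_total x (π / 2) with hx2 | hx2
      · have := wl (s * x) x ⟨hx.1, hx2⟩
        rw [sub_self, sin_zero, cos_zero] at this
        rw [hYl x ⟨hx.1, hx2⟩, sinConv, ← this]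
        ring
      · have := wr (s * x) x ⟨hx2, hx.2⟩
        rw [sub_self, sin_zero, cos_zero] at this
        rw [hYr x ⟨hx2, hx.2⟩, sinConv, ← this]
        ring
    change Y x = y₁ 0 * cos (s * x) + derivWithin y₁ left 0 * (sin (s * x) / s)
      - sinConv P s x / s
    field_simp
    linarith
  · have := wr (s * π + π / 2) π ⟨by linarith, le_rfl⟩
    rw [add_sub_cancel_left, sin_pi_div_two, cos_pi_div_two, sin_add_pi_div_two,
      cos_add_pi_div_two] at this
    rw [← cosConv_eq_integral_sin] at this
    change _ = _ - cosConv P s π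
    linarith

/-- Conversely, a solution of the integral equation, with its right half divided by the
transmission factor `κ`, solves the equation and the transmission conditions. -/
lemma Admissible.exists_isSolution_of_isVolterra (h : Admissible q Δ) {M a b : ℝ}
    (hd : DelayData (extPotential q) (extDelayed Δ) M) (hs : 0 < s) (hκ : κ ≠ 0) {Y : ℝ → ℝ}
    (hY : IsVolterra (extPotential q) (extDelayed Δ) a b s Y) :
    ∃ y₁ y₂, IsSolution q Δ (s ^ 2) y₁ y₂ ∧ y₁ 0 = a ∧ derivWithin y₁ left 0 = b ∧
      y₁ (π / 2) = κ * y₂ (π / 2) ∧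
      derivWithin y₁ left (π / 2) = κ * derivWithin y₂ right (π / 2) ∧
      κ * y₂ π = Y π ∧
      κ * derivWithin y₂ right π = -(a * s * sin (s * π)) + b * cos (s * π)
        - cosConv (fun τ => extPotential q τ * Y (extDelayed Δ τ)) s π := by
  have hpi := pi_pos
  obtain ⟨B, hB⟩ := exists_bound_Icc hY.cont
  set P : ℝ → ℝ := fun τ => extPotential q τ * Y (extDelayed Δ τ) with hPdef
  have hPc : ContinuousOn P {π / 2}ᶜ := hd.continuousOn_mul hY.cont
  have hPb := hd.abs_mul_le hB
  let W : ℝ → ℝ := fun x => a * cos (s * x) + b * (sin (s * x) / s) - sinConv P s x / s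
  let W' : ℝ → ℝ := fun x => -(a * s * sin (s * x)) + b * cos (s * x) - cosConv P s x
  have hWY : ∀ x ∈ Icc 0 π, W x = Y x := fun x hx => (hY.eqn x hx).symm
  have hlin : ∀ x, HasDerivAt (fun x => s * x) s x := fun x => by
    simpa using (hasDerivAt_id x).const_mul s
  have hW : ∀ x, HasDerivAt W (W' x) x := fun x => by
    refine ((((hlin x).cos.const_mul a).add (((hlin x).sin.div_const s).const_mul b)).sub
      ((hasDerivAt_sinConv hPc hPb s x).div_const s)).congr_deriv ?_
    simp only [W']
    field_simp
  have hW' : ∀ x, x ≠ π / 2 → HasDerivAt W' (-(P x + s ^ 2 * W x)) x := fun x hx => by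
    refine ((((hlin x).sin.const_mul (a * s)).neg.add ((hlin x).cos.const_mul b)).sub
      (hasDerivAt_cosConv hPc hPb s hx)).congr_deriv ?_
    simp only [W]
    field_simp
    ring
  have hW'c : Continuous W' := by
    have := continuous_cosConv hPc hPb s
    fun_prop
  let V : ℝ → ℝ := fun x => W x / κ
  have hl : ∀ x ∈ left, derivWithin W left x = W' x := fun x hx =>
    (hW x).hasDerivWithinAt.derivWithin (uniqueDiffOn_left x hx)
  have hr : ∀ x ∈ right, derivWithin V right x = W' x / κ := fun x hx =>
    ((hW x).div_const κ).hasDerivWithinAt.derivWithin (uniqueDiffOn_right x hx)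
  have m1 : π / 2 ∈ left := ⟨by linarith, le_rfl⟩
  have m2 : π / 2 ∈ right := ⟨le_rfl, by linarith⟩
  have m3 : π ∈ right := ⟨by linarith, le_rfl⟩
  have m4 : (0 : ℝ) ∈ left := ⟨le_rfl, by linarith⟩
  have hPx : ∀ x ∈ dom, P x = q x * W (x - Δ x) := fun x hx => by
    simp only [hPdef]
    rw [extPotential_of_mem (dom_subset_Icc hx), h.extDelayed_of_mem hx, hWY _ (h.sub_mem hx)]
  refine ⟨W, V, ⟨?_, ?_, fun x hx => ?_, ?_, ?_, fun x hx => ?_⟩, ?_, ?_, ?_, ?_, ?_, ?_⟩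
  · exact fun x _ => (hW x).differentiableAt.differentiableWithinAt
  · exact hW'c.continuousOn.congr hl
  · have hxd : x ∈ dom := Or.inl hx
    have := (hW' x (ne_of_mem_dom hxd)).hasDerivWithinAt (s := left)
    rw [hPx x hxd] at this
    exact this.congr hl (hl x ⟨hx.1, hx.2.le⟩)
  · exact fun x _ => ((hW x).div_const κ).differentiableAt.differentiableWithinAt
  · exact (hW'c.div_const κ).continuousOn.congr hr
  · have hxd : x ∈ dom := Or.inr hx
    have := ((hW' x (ne_of_mem_dom hxd)).div_const κ).hasDerivWithinAt (s := right)
    rw [hPx x hxd] at this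
    refine (this.congr hr (hr x ⟨hx.1.le, hx.2⟩)).congr_deriv ?_
    simp only [V]
    ring
  · simp [W, sinConv]
  · rw [hl 0 m4]; simp [W', cosConv]
  · simp only [V]; field_simp
  · rw [hl _ m1, hr _ m2]; field_simp
  · rw [← hWY π ⟨by linarith, le_rfl⟩]; simp only [V]; field_simp
  · rw [hr _ m3]; simp only [W']; field_simp

end

/-! ### The characteristic equation -/

/-- The lower-order part of the characteristic function: for the solution `Y` of the integral
equation with initial values `a, b`, the boundary condition at `π` reads
`s a sin β sin πs = charRest Q D b β s Y`. -/
noncomputable def charRest (Q D : ℝ → ℝ) (b β s : ℝ) (Y : ℝ → ℝ) : ℝ :=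
  cos β * Y π + sin β * (b * cos (s * π) - cosConv (fun τ => Q τ * Y (D τ)) s π)

section

variable {Q D Y Z : ℝ → ℝ} {M a b s t β : ℝ}

lemma pi_mem_Icc : π ∈ Icc 0 π := ⟨pi_pos.le, le_rfl⟩

lemma DelayData.charRest_congr (h : DelayData Q D M) (hYZ : ∀ x ∈ Icc 0 π, Y x = Z x) :
    charRest Q D b β s Y = charRest Q D b β s Z := by
  unfold charRest
  simp only [hYZ _ (h.mem _), hYZ _ pi_mem_Icc]

/-- Scaling the solution scales the boundary condition. -/
lemma DelayData.charRest_mul (h : DelayData Q D M) {c : ℝ} (hZ : ∀ x ∈ Icc 0 π, Z x = c * Y x) :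
    charRest Q D (c * b) β s Z = c * charRest Q D b β s Y := by
  have e : cosConv (fun τ => Q τ * Z (D τ)) s π = c * cosConv (fun τ => Q τ * Y (D τ)) s π := by
    unfold cosConv
    rw [← intervalIntegral.integral_const_mul]
    refine intervalIntegral.integral_congr fun τ _ => ?_
    simp only [hZ _ (h.mem τ)]
    ring
  unfold charRest
  rw [e, hZ π pi_mem_Icc]
  ring

lemma DelayData.abs_charRest_le (h : DelayData Q D M) (hs1 : 1 ≤ s) (hs : 2 * π * M ≤ s)
    (hY : IsVolterra Q D a b s Y) :
    |charRest Q D b β s Y|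
      ≤ 2 * (|a| + |b|) + (|b| + M * (2 * (|a| + |b|)) * 1 * π) := by
  have hB := h.abs_le_of_isVolterra hs1 hs hY
  have h1 := h.abs_integral_mul_le hB (w := fun τ => cos (s * π - s * τ)) (W := 1)
    (fun τ _ => abs_cos_le_one _) pi_mem_Icc
  have h2 : |b * cos (s * π)| ≤ |b| := by
    rw [abs_mul]; exact mul_le_of_le_one_right (abs_nonneg _) (abs_cos_le_one _)
  unfold charRest
  refine (abs_add_le _ _).trans (add_le_add ?_ ?_)
  · rw [abs_mul]
    exact (mul_le_of_le_one_left (abs_nonneg _) (abs_cos_le_one _)).trans (hB π pi_mem_Icc)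
  · rw [abs_mul]
    exact (mul_le_of_le_one_left (abs_nonneg _) (abs_sin_le_one _)).trans
      ((abs_sub _ _).trans (add_le_add h2 h1))

/-- The lower-order part of the characteristic function inherits the Lipschitz dependence of the
solution on the parameter. -/
lemma DelayData.exists_abs_charRest_sub_le (h : DelayData Q D M) (a b β : ℝ) :
    ∃ C, ∀ s t Y Z, 1 ≤ s → 2 * π * M ≤ s → 1 ≤ t → 2 * π * M ≤ t →
      IsVolterra Q D a b s Y → IsVolterra Q D a b t Z →
      |charRest Q D b β s Y - charRest Q D b β t Z| ≤ C * |s - t| := by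
  set Λ := 2 * (|a| * π + |b| * (π + 1) + M * (2 * (|a| + |b|)) * (π + 1) * π) with hΛ
  refine ⟨Λ + (|b| * π + (M * Λ * 1 * π + M * (2 * (|a| + |b|)) * π * π)),
    fun s t Y Z hs1 hs ht1 ht hY hZ => ?_⟩
  have hYc := hY.cont
  have hZc := hZ.cont
  have hL : ∀ x ∈ Icc 0 π, |Y x - Z x| ≤ Λ * |s - t| := fun x hx => by
    rw [hΛ, mul_assoc]
    exact h.abs_sub_le_of_isVolterra hs1 hs ht1 ht hY hZ x hx
  have e : cosConv (fun τ => Q τ * Y (D τ)) s π - cosConv (fun τ => Q τ * Z (D τ)) t π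
      = (∫ τ in (0 : ℝ)..π, Q τ * (fun x => Y x - Z x) (D τ) * cos (s * π - s * τ))
        + ∫ τ in (0 : ℝ)..π, Q τ * Z (D τ) * (cos (s * (π - τ)) - cos (t * (π - τ))) := by
    unfold cosConv
    rw [← intervalIntegral.integral_sub
        (h.intervalIntegrable hYc (by fun_prop) _ _) (h.intervalIntegrable hZc (by fun_prop) _ _),
      ← intervalIntegral.integral_add
        (h.intervalIntegrable (Y := fun x => Y x - Z x) (by fun_prop) (by fun_prop) _ _)
        (h.intervalIntegrable hZc (by fun_prop) _ _)]
    refine intervalIntegral.integral_congr fun τ _ => ?_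
    simp only [mul_sub]
    ring
  have h1 := h.abs_integral_mul_le hL (w := fun τ => cos (s * π - s * τ)) (W := 1)
    (fun τ _ => abs_cos_le_one _) pi_mem_Icc
  have h2 := h.abs_integral_mul_le (h.abs_le_of_isVolterra ht1 ht hZ)
    (w := fun τ => cos (s * (π - τ)) - cos (t * (π - τ))) (W := π * |s - t|)
    (fun τ hτ => abs_cos_mul_sub_le s t (abs_sub_le_pi pi_mem_Icc hτ)) pi_mem_Icc
  have h3 : |b * (cos (s * π) - cos (t * π))| ≤ |b| * (π * |s - t|) := by
    rw [abs_mul]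
    exact mul_le_mul_of_nonneg_left (abs_cos_mul_sub_le s t (abs_le_pi pi_mem_Icc)) (abs_nonneg _)
  have e2 : charRest Q D b β s Y - charRest Q D b β t Z = cos β * (Y π - Z π)
      + sin β * (b * (cos (s * π) - cos (t * π))
        - (cosConv (fun τ => Q τ * Y (D τ)) s π - cosConv (fun τ => Q τ * Z (D τ)) t π)) := by
    unfold charRest; ring
  rw [e2, e]
  have h4 : |cos β * (Y π - Z π)| ≤ Λ * |s - t| := by
    rw [abs_mul]
    exact (mul_le_of_le_one_left (abs_nonneg _) (abs_cos_le_one _)).trans (hL π pi_mem_Icc)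
  refine (abs_add_le _ _).trans ((add_le_add h4 ?_).trans (le_of_eq (add_mul _ _ _).symm))
  rw [abs_mul]
  refine (mul_le_of_le_one_left (abs_nonneg _) (abs_sin_le_one _)).trans
    ((abs_sub _ _).trans ((add_le_add h3 ((abs_add_le _ _).trans (add_le_add h1 h2))).trans
      (le_of_eq ?_)))
  ring

/-- The characteristic equation up to `O(1/s)`, divided by its leading coefficient. -/
lemma DelayData.abs_charEq_expansion_le (h : DelayData Q D M) (hs1 : 1 ≤ s) (hs : 2 * π * M ≤ s)
    (ha : a ≠ 0) (hβ : sin β ≠ 0) (hY : IsVolterra Q D a b s Y)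
    (hroot : s * (a * sin β * sin (s * π)) = charRest Q D b β s Y) :
    |s * sin (s * π) - ((cos β / sin β + b / a - L Q (fun τ => τ - D τ) π s) * cos (s * π)
      - K Q (fun τ => τ - D τ) π s * sin (s * π))|
      ≤ (((|b| + M * (2 * (|a| + |b|)) * π)
        + (M * (|b| + M * (2 * (|a| + |b|)) * π) * π + |a| * M)) / |a * sin β|) / s := by
  have hs0 : 0 < s := by linarith
  have h1 := h.abs_sub_cos_le_of_isVolterra hs1 hs hY π pi_mem_Icc
  have h2 := h.abs_integral_sub_le hs1 hs hY (s * π + π / 2) pi_mem_Icc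
  rw [← cosConv_eq_integral_sin (fun τ => Q τ * Y (D τ)), sin_add_pi_div_two,
    cos_add_pi_div_two] at h2
  set e₁ := Y π - a * cos (s * π) with he₁
  set e₂ := cosConv (fun τ => Q τ * Y (D τ)) s π - a * (cos (s * π) *
    L Q (fun τ => τ - D τ) π s - -sin (s * π) * K Q (fun τ => τ - D τ) π s) with he₂
  have e : s * sin (s * π) - ((cos β / sin β + b / a - L Q (fun τ => τ - D τ) π s) * cos (s * π)
      - K Q (fun τ => τ - D τ) π s * sin (s * π)) = (cos β * e₁ - sin β * e₂) / (a * sin β) := by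
    rw [eq_div_iff (mul_ne_zero ha hβ)]
    rw [charRest] at hroot
    rw [he₁, he₂]
    field_simp
    linear_combination hroot
  rw [e, abs_div, div_right_comm]
  refine div_le_div_of_nonneg_right ?_ (abs_nonneg _)
  rw [add_div]
  refine (abs_sub _ _).trans (add_le_add ?_ ?_)
  · rw [abs_mul]
    exact (mul_le_of_le_one_left (abs_nonneg _) (abs_cos_le_one _)).trans h1
  · rw [abs_mul]
    exact (mul_le_of_le_one_left (abs_nonneg _) (abs_sin_le_one _)).trans h2

lemma DelayData.abs_expansion_le (h : DelayData Q D M) (hs1 : 1 ≤ s) (hs : 2 * π * M ≤ s)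
    (ha : a ≠ 0) (hY : IsVolterra Q D a b s Y) {x : ℝ} (hx : x ∈ Icc 0 π) :
    |Y x - a * (cos (s * x) * (1 + K Q (fun τ => τ - D τ) x s / s)
      - sin (s * x) * (-(b / a) + L Q (fun τ => τ - D τ) x s) / s)|
      ≤ (M * (|b| + M * (2 * (|a| + |b|)) * π) * π + |a| * M) / s ^ 2 := by
  have hs0 : 0 < s := by linarith
  have h1 := h.abs_integral_sub_le hs1 hs hY (s * x) hx
  have e : Y x - a * (cos (s * x) * (1 + K Q (fun τ => τ - D τ) x s / s)
      - sin (s * x) * (-(b / a) + L Q (fun τ => τ - D τ) x s) / s)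
      = -(((∫ τ in (0 : ℝ)..x, Q τ * Y (D τ) * sin (s * x - s * τ))
        - a * (sin (s * x) * L Q (fun τ => τ - D τ) x s
          - cos (s * x) * K Q (fun τ => τ - D τ) x s)) / s) := by
    rw [hY.eqn x hx, sinConv]
    field_simp
    ring
  rw [e, abs_neg, abs_div, abs_of_pos hs0, sq, ← div_div]
  exact div_le_div_of_nonneg_right h1 hs0.le

/-- The expansion at the root `s`, rewritten in terms of the integer `n` next to it; `g / (n π)` is
the leading term of `s - n`, and `G` bounds the coefficients. -/
lemma DelayData.abs_expansion_nat_le (h : DelayData Q D M) (hs1 : 1 ≤ s) (hs : 2 * π * M ≤ s)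
    (ha : a ≠ 0) (hY : IsVolterra Q D a b s Y) {n c g G S E : ℝ} (hn1 : 1 ≤ n)
    (hsn : |s - n| ≤ 1 / 2) (hsc : |s - n| ≤ c / n) (hshift : |(s - n) - g / (n * π)| ≤ S / n ^ 2)
    (hG : |b / a| + M * π + M * π * π ≤ G)
    (hE : M * (|b| + M * (2 * (|a| + |b|)) * π) * π + |a| * M = E) {x : ℝ} (hx : x ∈ Icc 0 π) :
    |Y x - a * (cos (n * x) * (1 + K Q (fun τ => τ - D τ) x n / n)
        - sin (n * x) / (n * π) * (g * x + (-(b / a) + L Q (fun τ => τ - D τ) x n) * π))|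
      ≤ (4 * E + |a| * (((c * π) ^ 2 + (c * π) ^ 3) + π * S + 2 * G * (π + 2) * c
        + 2 * G * (π + 2) * c)) / n ^ 2 := by
  have hM := h.nonneg
  have hpi := pi_pos
  have hn0 : 0 < n := by linarith
  have hs0 : 0 < s := by linarith
  have hsn2 : n / 2 ≤ s := by linarith [(abs_le.1 hsn).1]
  have p1 : 0 ≤ M * π := by positivity
  have p2 : 0 ≤ M * π * π := by positivity
  have n2 := abs_nonneg (b / a)
  have hGd : M * π * π * |s - n| ≤ G * |s - n| :=
    mul_le_mul_of_nonneg_right (by linarith) (abs_nonneg _)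
  have hK : ∀ r : ℝ, |K Q (fun τ => τ - D τ) x r| ≤ G := fun r =>
    (h.abs_K_le r hx).trans (by linarith)
  have hA : ∀ r : ℝ, |-(b / a) + L Q (fun τ => τ - D τ) x r| ≤ G := fun r => by
    have := h.abs_L_le r hx
    refine (abs_add_le _ _).trans ?_
    rw [abs_neg]; linarith
  have t0 := h.abs_expansion_le hs1 hs ha hY hx
  have hE0 : 0 ≤ E := by rw [← hE]; positivity
  rw [hE] at t0
  have t0' : E / s ^ 2 ≤ 4 * E / n ^ 2 := by
    rw [div_le_div_iff₀ (by positivity) (by positivity)]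
    have h1 : n ^ 2 ≤ (2 * s) ^ 2 := pow_le_pow_left₀ hn0.le (by linarith) 2
    have h2 := mul_le_mul_of_nonneg_left h1 hE0
    linarith
  have t1 := abs_cos_mul_taylor_le hn1 hsc hx
  have t2 : |x * sin (n * x) * ((s - n) - g / (n * π))| ≤ π * S / n ^ 2 := by
    rw [abs_mul, mul_div_assoc]
    refine mul_le_mul ?_ hshift (abs_nonneg _) hpi.le
    rw [abs_mul]
    exact (mul_le_of_le_one_right (abs_nonneg _) (abs_sin_le_one _)).trans (abs_le_pi hx)
  have t3 := abs_mul_div_sub_le (f := cos (s * x)) (f' := cos (n * x)) hn0 hsn2 hsc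
    (abs_cos_le_one _) (abs_cos_mul_sub_le s n (abs_le_pi hx)) (hK s) (hK n)
    ((h.abs_K_sub_le s n hx).trans hGd) hn1
  have t4 := abs_mul_div_sub_le (f := sin (s * x)) (f' := sin (n * x)) hn0 hsn2 hsc
    (abs_sin_le_one _) (abs_sin_mul_sub_le s n (abs_le_pi hx)) (hA s) (hA n)
    (by
      rw [add_sub_add_left_eq_sub]
      exact (h.abs_L_sub_le s n hx).trans hGd) hn1
  have e : Y x - a * (cos (n * x) * (1 + K Q (fun τ => τ - D τ) x n / n)
        - sin (n * x) / (n * π) * (g * x + (-(b / a) + L Q (fun τ => τ - D τ) x n) * π))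
      = (Y x - a * (cos (s * x) * (1 + K Q (fun τ => τ - D τ) x s / s)
          - sin (s * x) * (-(b / a) + L Q (fun τ => τ - D τ) x s) / s))
        + a * ((cos (s * x) - cos (n * x) + (s - n) * x * sin (n * x))
          - x * sin (n * x) * ((s - n) - g / (n * π))
          + (cos (s * x) * K Q (fun τ => τ - D τ) x s / s
            - cos (n * x) * K Q (fun τ => τ - D τ) x n / n)
          - (sin (s * x) * (-(b / a) + L Q (fun τ => τ - D τ) x s) / s
            - sin (n * x) * (-(b / a) + L Q (fun τ => τ - D τ) x n) / n)) := by
    have e1 : sin (n * x) / (n * π) * (g * x + (-(b / a) + L Q (fun τ => τ - D τ) x n) * π)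
        = x * sin (n * x) * (g / (n * π))
          + sin (n * x) * (-(b / a) + L Q (fun τ => τ - D τ) x n) / n := by
      field_simp
    rw [e1]
    ring
  have t5 := mul_le_mul_of_nonneg_left ((abs_sub _ _).trans (add_le_add ((abs_add_le _ _).trans
    (add_le_add ((abs_sub _ _).trans (add_le_add t1 t2)) t3)) t4)) (abs_nonneg a)
  rw [← abs_mul] at t5
  rw [e]
  refine (abs_add_le _ _).trans ((add_le_add (t0.trans t0') t5).trans (le_of_eq ?_))
  ring

/-- Asymptotics on the level of the integral equation: for large `n` there is exactly one root of
the characteristic equation within `1/2` of `n`, and the corresponding solution has the stated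
expansion on all of `[0, π]`. -/
lemma DelayData.exists_asymptotics (h : DelayData Q D M) (ha : a ≠ 0) (b : ℝ)
    (hβ : sin β ≠ 0) :
    ∃ (N : ℕ) (C : ℝ), ∀ n : ℕ, N ≤ n → 1 ≤ n ∧
      (∀ t : ℝ, |t - n| ≤ 1 / 2 → 1 ≤ t ∧ 2 * π * M ≤ t) ∧
      ∃ s : ℝ, |s - n| ≤ 1 / 2 ∧ |s - n| ≤ C / n ∧
      (∀ (t : ℝ) (Y : ℝ → ℝ), |t - n| ≤ 1 / 2 → IsVolterra Q D a b t Y →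
        t * (a * sin β * sin (t * π)) = charRest Q D b β t Y → t = s) ∧
      ∀ Y, IsVolterra Q D a b s Y →
        s * (a * sin β * sin (s * π)) = charRest Q D b β s Y ∧
        ∀ x ∈ Icc 0 π, |Y x| ≤ C ∧
          |Y x - a * (cos (n * x) * (1 + K Q (fun τ => τ - D τ) x n / n)
            - sin (n * x) / (n * π) *
              ((cos β / sin β + b / a - L Q (fun τ => τ - D τ) π n) * x
                + (-(b / a) + L Q (fun τ => τ - D τ) x n) * π))| ≤ C / n ^ 2 := by
  set s₀ : ℝ := max 1 (2 * π * M)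
  have hs₀' : ∀ s ≥ s₀, 1 ≤ s ∧ 2 * π * M ≤ s := fun s hs =>
    ⟨(le_max_left _ _).trans hs, (le_max_right _ _).trans hs⟩
  have hex : ∀ s : ℝ, ∃ Y : ℝ → ℝ, s₀ ≤ s → IsVolterra Q D a b s Y := fun s => by
    by_cases hs : s₀ ≤ s
    · obtain ⟨Y, hY⟩ := h.exists_isVolterra a b (by linarith [(hs₀' s hs).1]) (hs₀' s hs).2
      exact ⟨Y, fun _ => hY⟩
    · exact ⟨0, fun h' => absurd h' hs⟩
  choose Φ hΦ using hex
  obtain ⟨C₁, hC₁⟩ := h.exists_abs_charRest_sub_le a b β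
  set B := 2 * (|a| + |b|)
  set C₂ := B + (|b| + M * B * 1 * π)
  obtain ⟨N₀, c, hN₀⟩ := exists_unique_zero_near (R := fun s => charRest Q D b β s (Φ s))
    (A := a * sin β) (C := max C₁ C₂) (s₀ := s₀) (mul_ne_zero ha hβ)
    (fun s hs => (h.abs_charRest_le (hs₀' s hs).1 (hs₀' s hs).2 (hΦ s hs)).trans
      (le_max_right _ _))
    (fun s hs t ht => (hC₁ s t _ _ (hs₀' s hs).1 (hs₀' s hs).2 (hs₀' t ht).1 (hs₀' t ht).2
      (hΦ s hs) (hΦ t ht)).trans (mul_le_mul_of_nonneg_right (le_max_left _ _) (abs_nonneg _)))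
  obtain ⟨N₁, hN₁⟩ := exists_nat_gt (s₀ + 1)
  have hM := h.nonneg
  -- constants: `E` for the integral term, `G` for the coefficients, `S` for the root
  set E := M * (|b| + M * B * π) * π + |a| * M
  set G := |cos β / sin β + b / a| + |b / a| + M * π + M * π * π with hG
  set X := ((|b| + M * B * π) + E) / |a * sin β|
  set S := π * c ^ 2 + 2 * π ^ 3 * c ^ 3 + G * π ^ 2 * c ^ 2 + G * π * c + 2 * X + G * c
  set F := 4 * E + |a| * (((c * π) ^ 2 + (c * π) ^ 3) + π * S + 2 * G * (π + 2) * c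
    + 2 * G * (π + 2) * c)
  refine ⟨max N₀ N₁, max c (max B F), fun n hn => ?_⟩
  obtain ⟨s, hsn, hsc, hroot, huniq⟩ := hN₀ n ((le_max_left _ _).trans hn)
  have hnN : (N₁ : ℝ) ≤ n := by exact_mod_cast (le_max_right _ _).trans hn
  have hlarge : ∀ t : ℝ, |t - n| ≤ 1 / 2 → s₀ ≤ t := fun t ht => by
    linarith [(abs_le.1 ht).1]
  have hn1 : (1 : ℝ) ≤ n := by
    have : 1 ≤ s₀ := le_max_left _ _
    linarith
  have hn0 : (0 : ℝ) < n := by linarith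
  -- the characteristic equation does not depend on the choice of the solution
  have hindep : ∀ t Y, s₀ ≤ t → IsVolterra Q D a b t Y →
      charRest Q D b β t Y = charRest Q D b β t (Φ t) := fun t Y ht hY =>
    h.charRest_congr fun x hx => by
      have := h.eq_mul_of_isVolterra (c := 1) (by linarith [(hs₀' t ht).1]) (hs₀' t ht).2
        (hΦ t ht) (by simpa using hY) x hx
      rwa [one_mul] at this
  refine ⟨by exact_mod_cast hn1, fun t ht => hs₀' t (hlarge t ht), s, hsn,
    hsc.trans (div_le_div_of_nonneg_right (le_max_left _ _) hn0.le), fun t Y ht hY hr => ?_,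
    fun Y hY => ?_⟩
  · rw [hindep t Y (hlarge t ht) hY] at hr
    exact huniq t ht hr
  have hs1 := (hs₀' s (hlarge s hsn)).1
  have hs2 := (hs₀' s (hlarge s hsn)).2
  have hr : s * (a * sin β * sin (s * π)) = charRest Q D b β s Y := by
    rw [hindep s Y (hlarge s hsn) hY]; exact hroot
  refine ⟨hr, fun x hx => ⟨(h.abs_le_of_isVolterra hs1 hs2 hY x hx).trans
    ((le_max_left _ _).trans (le_max_right _ _)), ?_⟩⟩
  have p1 : 0 ≤ M * π := by positivity
  have p2 : 0 ≤ M * π * π := by positivity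
  have n1 := abs_nonneg (cos β / sin β + b / a)
  have n2 := abs_nonneg (b / a)
  have hGd : M * π * π * |s - n| ≤ G * |s - n| :=
    mul_le_mul_of_nonneg_right (by rw [hG]; linarith) (abs_nonneg _)
  have hshift := abs_shift_sub_le (C₁ := G) (C₂ := X) (by exact_mod_cast hn1) hsn hsc
    (G' := cos β / sin β + b / a - L Q (fun τ => τ - D τ) π n) (by
      have := h.abs_L_le s pi_mem_Icc
      refine (abs_sub _ _).trans ?_
      rw [hG]; linarith)
    ((h.abs_K_le s pi_mem_Icc).trans (by rw [hG]; linarith))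
    (by
      rw [sub_sub_sub_cancel_left, abs_sub_comm]
      exact (h.abs_L_sub_le s n pi_mem_Icc).trans hGd)
    (h.abs_charEq_expansion_le hs1 hs2 ha hβ hY hr)
  refine (h.abs_expansion_nat_le hs1 hs2 ha hY hn1 hsn hsc hshift (G := G) (by rw [hG]; linarith)
    (E := E) rfl hx).trans ?_
  exact div_le_div_of_nonneg_right ((le_max_right _ _).trans (le_max_right _ _)) (by positivity)

end

/-! ### Eigenvalues and eigenfunctions -/

lemma cbrt_sq {s : ℝ} (hs : 0 < s) : cbrt (s ^ 2) = s ^ (2 / 3 : ℝ) := by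
  rw [cbrt, if_pos (by positivity), ← rpow_natCast s 2, ← rpow_mul hs.le]
  norm_num

section

variable {q Δ : ℝ → ℝ} {α β δ s M : ℝ}

/-- Eigenfunctions come from the integral equation with initial values `c sin α`, `-c cos α`, and
turn the boundary condition at `π` into the characteristic equation. -/
lemma Admissible.isVolterra_of_isEigenfunction (h : Admissible q Δ)
    (hd : DelayData (extPotential q) (extDelayed Δ) M) (hs : 0 < s) (hα : sin α ≠ 0)
    {y₁ y₂ : ℝ → ℝ} (hy : IsEigenfunction q Δ α β δ (s ^ 2) y₁ y₂) :
    ∃ Y, IsVolterra (extPotential q) (extDelayed Δ) (y₁ 0 / sin α * sin α)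
        (y₁ 0 / sin α * -cos α) s Y ∧
      (∀ x ∈ left, Y x = y₁ x) ∧ (∀ x ∈ right, Y x = s ^ (2 / 3 : ℝ) * δ * y₂ x) ∧
      s * (y₁ 0 / sin α * sin α * sin β * sin (s * π))
        = charRest (extPotential q) (extDelayed Δ) (y₁ 0 / sin α * -cos α) β s Y := by
  have hpi := pi_pos
  have ht := hy.trans
  have ht' := hy.trans_deriv
  rw [cbrt_sq hs] at ht ht'
  obtain ⟨Y, hY, hl, hr, hπ⟩ := h.exists_isVolterra_of_isSolution hd hs hy.sol
    (sub_eq_zero.1 ht) (sub_eq_zero.1 ht')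
  have e1 : y₁ 0 / sin α * sin α = y₁ 0 := div_mul_cancel₀ _ hα
  have e2 : y₁ 0 / sin α * -cos α = derivWithin y₁ left 0 := by
    field_simp
    linarith [hy.bc_zero]
  rw [e1, e2]
  refine ⟨Y, hY, hl, hr, ?_⟩
  rw [charRest, hr π ⟨by linarith, le_rfl⟩]
  linear_combination sin β * hπ - s ^ (2 / 3 : ℝ) * δ * hy.bc_pi

/-- For large `s`, a square `s²` is an eigenvalue only if the normalized solution of the integral
equation satisfies the characteristic equation. -/
lemma Admissible.charEq_of_isEigenvalue (h : Admissible q Δ)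
    (hd : DelayData (extPotential q) (extDelayed Δ) M) (hs0 : 0 < s) (hs : 2 * π * M ≤ s)
    (hα : sin α ≠ 0) (hδ : δ ≠ 0) (hev : IsEigenvalue q Δ α β δ (s ^ 2)) {Y : ℝ → ℝ}
    (hY : IsVolterra (extPotential q) (extDelayed Δ) (sin α) (-cos α) s Y) :
    s * (sin α * sin β * sin (s * π))
      = charRest (extPotential q) (extDelayed Δ) (-cos α) β s Y := by
  obtain ⟨y₁, y₂, hy⟩ := hev
  obtain ⟨Z, hZ, hl, hr, hroot⟩ := h.isVolterra_of_isEigenfunction hd hs0 hα hy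
  have hZY := hd.eq_mul_of_isVolterra hs0 hs hY hZ
  rw [hd.charRest_mul hZY] at hroot
  set c := y₁ 0 / sin α
  have hκ : s ^ (2 / 3 : ℝ) * δ ≠ 0 := mul_ne_zero (rpow_pos_of_pos hs0 _).ne' hδ
  have hc0 : c ≠ 0 := by
    intro hc0
    rcases hy.nontrivial with ⟨x, hx, hne⟩ | ⟨x, hx, hne⟩
    · have hx' : x ∈ Icc 0 π := dom_subset_Icc (Or.inl hx)
      rw [← hl x ⟨hx.1, hx.2.le⟩, hZY x hx', hc0, zero_mul] at hne
      exact hne rfl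
    · have hx' : x ∈ Icc 0 π := dom_subset_Icc (Or.inr hx)
      have h1 := hr x ⟨hx.1.le, hx.2⟩
      rw [hZY x hx', hc0, zero_mul] at h1
      exact hne ((mul_eq_zero.1 h1.symm).resolve_left hκ)
  refine mul_left_cancel₀ hc0 ?_
  linear_combination hroot

/-- A root of the characteristic equation yields a normalized eigenfunction. -/
lemma Admissible.exists_isNormalizedEigenfunction (h : Admissible q Δ)
    (hd : DelayData (extPotential q) (extDelayed Δ) M) (hs : 0 < s) (hα : sin α ≠ 0)
    (hδ : δ ≠ 0) {Y : ℝ → ℝ}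
    (hY : IsVolterra (extPotential q) (extDelayed Δ) (sin α) (-cos α) s Y)
    (hroot : s * (sin α * sin β * sin (s * π))
      = charRest (extPotential q) (extDelayed Δ) (-cos α) β s Y) :
    ∃ u₁ u₂, IsNormalizedEigenfunction q Δ α β δ (s ^ 2) u₁ u₂ := by
  have hκ : s ^ (2 / 3 : ℝ) * δ ≠ 0 := mul_ne_zero (rpow_pos_of_pos hs _).ne' hδ
  obtain ⟨y₁, y₂, hsol, i0, i1, t0, t1, p0, p1⟩ := h.exists_isSolution_of_isVolterra hd hs hκ hY
  refine ⟨y₁, y₂, ⟨hsol, ?_, ?_, ?_, ?_, Or.inl ⟨0, ⟨le_rfl, pi_div_two_pos⟩, ?_⟩⟩, i0, i1⟩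
  · rw [i0, i1]; ring
  · rw [charRest] at hroot
    refine (mul_eq_zero.1 ?_).resolve_left hκ
    linear_combination cos β * p0 + sin β * p1 - hroot
  · rw [cbrt_sq hs, t0, sub_self]
  · rw [cbrt_sq hs, t1, sub_self]
  · rw [i0]; exact hα

end

end RetardedBVP

open RetardedBVP in
theorem theorem5 (q Δ : ℝ → ℝ) (α β δ : ℝ)
    (hqΔ : RetardedBVP.Admissible q Δ)
    (ha : RetardedBVP.CondA q Δ) (hb : RetardedBVP.CondB Δ)
    (hα : Real.sin α ≠ 0) (hβ : Real.sin β ≠ 0) (hδ : δ ≠ 0) :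
    ∃ (N : ℕ) (C : ℝ), ∀ n : ℕ, N ≤ n →
      ∃ lam : ℝ,
        -- `lam` is the only eigenvalue near `n ^ 2`
        (0 < lam ∧ RetardedBVP.IsEigenvalue q Δ α β δ lam ∧
          |√lam - n| ≤ C / (n : ℝ) ^ (1 / 3 : ℝ)) ∧
        (∀ μ : ℝ, 0 < μ → |√μ - n| ≤ 1 / 2 →
          RetardedBVP.IsEigenvalue q Δ α β δ μ → μ = lam) ∧
        -- its normalized eigenfunction exists and has the asymptotic representation
        (∃ u₁ u₂ : ℝ → ℝ, RetardedBVP.IsNormalizedEigenfunction q Δ α β δ lam u₁ u₂) ∧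
        (∀ u₁ u₂ : ℝ → ℝ, RetardedBVP.IsNormalizedEigenfunction q Δ α β δ lam u₁ u₂ →
          (∀ x ∈ Set.Ico 0 (Real.pi / 2),
            |u₁ x - Real.sin α *
              (Real.cos (n * x) * (1 + RetardedBVP.K q Δ x n / n)
                - Real.sin (n * x) / (n * Real.pi) *
                  ((Real.cot β - Real.cot α - RetardedBVP.L q Δ Real.pi n) * x
                    + (Real.cot α + RetardedBVP.L q Δ x n) * Real.pi))|
              ≤ C / (n : ℝ) ^ 2) ∧
          (∀ x ∈ Set.Ioc (Real.pi / 2) Real.pi,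
            |u₂ x - Real.sin α / ((n : ℝ) ^ (2 / 3 : ℝ) * δ) *
              (Real.cos (n * x) * (1 + RetardedBVP.K q Δ x n / n)
                - Real.sin (n * x) / (n * Real.pi) *
                  ((Real.cot β - Real.cot α - RetardedBVP.L q Δ Real.pi n) * x
                    + (Real.cot α + RetardedBVP.L q Δ x n) * Real.pi))|
              ≤ C / (n : ℝ) ^ 2)) := by
  obtain ⟨M, hd⟩ := hqΔ.exists_delayData ha hb
  obtain ⟨N, C, hN⟩ := hd.exists_asymptotics hα (-Real.cos α) hβ
  refine ⟨N, max C ((C * C + C) / |δ|), fun n hn => ?_⟩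
  obtain ⟨hn1, hlarge, s, hsn, hsc, huniq, hall⟩ := hN n hn
  have hn1' : (1 : ℝ) ≤ n := by exact_mod_cast hn1
  have hn0 : (0 : ℝ) < n := by linarith
  obtain ⟨hs1, hs2⟩ := hlarge s hsn
  have hs0 : 0 < s := by linarith
  obtain ⟨Y, hY⟩ := hd.exists_isVolterra (Real.sin α) (-Real.cos α) hs0 hs2
  obtain ⟨hroot, hasym⟩ := hall Y hY
  obtain ⟨u, v, huv⟩ := hqΔ.exists_isNormalizedEigenfunction hd hs0 hα hδ hY hroot
  have hC0 : 0 ≤ C := by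
    have := (abs_nonneg _).trans hsc
    rwa [le_div_iff₀ hn0, zero_mul] at this
  refine ⟨s ^ 2, ⟨by positivity, ⟨u, v, huv.eigen⟩, ?_⟩, fun μ hμ hμn hev => ?_, ⟨u, v, huv⟩,
    fun u₁ u₂ hu => ?_⟩
  · rw [Real.sqrt_sq hs0.le]
    refine hsc.trans (div_le_div₀ (hC0.trans (le_max_left _ _)) (le_max_left _ _)
      (Real.rpow_pos_of_pos hn0 _) ?_)
    calc (n : ℝ) ^ (1 / 3 : ℝ) ≤ (n : ℝ) ^ (1 : ℝ) :=
          Real.rpow_le_rpow_of_exponent_le hn1' (by norm_num)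
      _ = n := Real.rpow_one _
  · obtain ⟨ht1, ht2⟩ := hlarge _ hμn
    have ht0 : 0 < √μ := by linarith
    obtain ⟨Z, hZ⟩ := hd.exists_isVolterra (Real.sin α) (-Real.cos α) ht0 ht2
    have hμ2 : (√μ) ^ 2 = μ := Real.sq_sqrt hμ.le
    rw [← hμ2] at hev
    rw [← hμ2, huniq _ Z hμn hZ (hqΔ.charEq_of_isEigenvalue hd ht0 ht2 hα hδ hev hZ)]
  obtain ⟨Z, hZ, hl, hr, -⟩ := hqΔ.isVolterra_of_isEigenfunction hd hs0 hα hu.eigen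
  rw [hu.init, div_self hα, one_mul, one_mul] at hZ
  have hZa := (hall Z hZ).2
  have hcot : ∀ θ, Real.cot θ = Real.cos θ / Real.sin θ := Real.cot_eq_cos_div_sin
  have ebα : Real.cos β / Real.sin β + -Real.cos α / Real.sin α
      = Real.cot β - Real.cot α := by
    rw [hcot, hcot]; ring
  have eα : -(-Real.cos α / Real.sin α) = Real.cot α := by
    rw [hcot]; ring
  rw [ebα, eα] at hZa
  refine ⟨fun x hx => ?_, fun x hx => ?_⟩
  · have hx' : x ∈ Set.Icc 0 Real.pi := dom_subset_Icc (Or.inl hx)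
    have h1 := (hZa x hx').2
    rw [hqΔ.K_ext_eq _ hx', hqΔ.L_ext_eq _ hx', hqΔ.L_ext_eq _ pi_mem_Icc,
      hl x ⟨hx.1, hx.2.le⟩] at h1
    exact h1.trans (div_le_div_of_nonneg_right (le_max_left _ _) (by positivity))
  · have hx' : x ∈ Set.Icc 0 Real.pi := dom_subset_Icc (Or.inr hx)
    obtain ⟨h0, h1⟩ := hZa x hx'
    have h2 := abs_div_rpow_sub_le hn1' hs1 hδ hsc h0 h1
    rw [hqΔ.K_ext_eq _ hx', hqΔ.L_ext_eq _ hx', hqΔ.L_ext_eq _ pi_mem_Icc,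
      hr x ⟨hx.1.le, hx.2⟩,
      mul_div_cancel_left₀ _ (mul_ne_zero (Real.rpow_pos_of_pos hs0 _).ne' hδ),
      mul_div_right_comm] at h2
    exact h2.trans (div_le_div_of_nonneg_right (le_max_right _ _) (by positivity))
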